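/- Let $\mathcal F$ be a commutative $\mathbb C$-algebra with a $\mathbb C$-linear derivation $\partial_X$ (a differential ring of functions of $X=t_0$), and put $\mathcal B=\mathcal F((\epsilon))[[t_1,t_2,\dots]]$, with the derivations $\partial_0=\partial_X$ (acting on coefficients) and $\partial_j=\partial/\partial t_j$, $j\ge1$. Let $q,r\in\mathcal B$ with $q$ invertible in $\mathcal B$. Define $A_n,B_n,C_n\in\mathcal B$ $(n\ge0)$ by $A_0=0$, $B_0=q$, $C_0=-r$ and $$B_{n+1}=\tfrac12\epsilon\,\partial_XB_n+qA_n,\qquad C_{n+1}=-\tfrac12\epsilon\,\partial_XC_n-rA_n,\qquad A_{n+1}=-\tfrac12\sum_{i+j=n,\;i,j\ge0}(A_iA_j+B_iC_j),$$ and let $$R(\xi)=\begin{pmatrix}2+\sum_{n\ge0}A_n\xi^{-n-1}&\sum_{n\ge0}B_n\xi^{-n-1}\\ \sum_{n\ge0}C_n\xi^{-n-1}&-\sum_{n\ge0}A_n\xi^{-n-1}\end{pmatrix},\qquad V_j(\xi)=\bigl(\xi^{j+1}R(\xi)\bigr)_+,\qquad \mathcal L(\xi)=\epsilon\partial_X+\begin{pmatrix}-\xi&-q\\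 r&\xi\end{pmatrix},$$ where $(\cdot)_+$ is the part polynomial in $\xi$ (constant term included); $R$ is the basic matrix resolvent of $\mathcal L$. Assume that $(q,r)$ is a solution of the AKNS hierarchy, i.e. $\partial_j\mathcal L(\xi)=2^j\epsilon^{-1}[V_j(\xi),\mathcal L(\xi)]$ for all $j\ge0$. Let $\tau$ be a tau-function of this solution: $\log\tau\in\mathcal B$ (such a $\log\tau$ exists after enlarging $\mathcal F$ if necessary) and the functions $\Omega_{i,j}=\epsilon^2\partial_i\partial_j\log\tau$ satisfy $$\sum_{i,j\ge0}\frac{\Omega_{i,j}}{2^{i+j}\,\xi^{i+2}\nu^{j+2}}=\frac{\operatorname{Tr}R(\xi)R(\nu)-4}{(\xi-\nu)^2}.$$ For $k\ge2$ and $i_1,\dots,i_k\ge0$ let $\Omega_{i_1,\dots,i_k}=\epsilon^k\partial_{i_1}\cdots\partial_{i_k}\log\tau$ be the $k$-point correlation functions. Let $e^{\pm\theta(\xi)}$, $\theta(\xi)=\epsilon^{-1}\sum_{k\ge0}2^kt_k\xi^{k+1}$, be formal exponentials, with $\partial_ke^{\pm\theta(\xi)}=\pm\epsilon^{-1}2^k\xi^{k+1}e^{\pm\theta(\xi)}$.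 Let $\psi_A(\xi)=\phi_A(\xi)e^{\theta(\xi)}$ and $\psi_B(\xi)=\phi_B(\xi)\,q\,e^{-\theta(\xi)}$, where $\phi_A,\phi_B\in1+\xi^{-1}\mathcal B[[\xi^{-1}]]$, be wave functions of type A and B of the solution; that is, for $\psi=\psi_A$ and for $\psi=\psi_B$ the vector $\Psi=\bigl(\psi,(\epsilon\psi_X-\xi\psi)/q\bigr)^T$ satisfies $$\partial_k\Psi=\epsilon^{-1}2^k\bigl(V_k(\xi)-\xi^{k+1}I\bigr)\Psi\qquad\text{for all }k\ge0.$$ Assume that they form a pair: $\epsilon\,(\psi_A\psi_{B,X}-\psi_{A,X}\psi_B)/q=-2\xi$. Put $$D(\xi,\nu)=\frac{\epsilon\bigl(\psi_A(\xi)\psi_{B,X}(\nu)-\psi_{A,X}(\xi)\psi_B(\nu)\bigr)}{(\xi-\nu)\,q}+\frac{\psi_A(\xi)\psi_B(\nu)}{q}.$$ Then for every $k\ge2$ $$\sum_{i_1,\dots,i_k\ge0}\Omega_{i_1,\dots,i_k}\prod_{j=1}^k\frac1{2^{i_j}\xi_j^{i_j+2}}=-\frac1{\prod_{j=1}^k\xi_j}\sum_{\sigma\in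 S_k/C_k}\ \prod_{j=1}^kD(\xi_{\sigma(j+1)},\xi_{\sigma(j)})-\frac{4\delta_{k,2}}{(\xi_1-\xi_2)^2},$$ where $\sigma(k+1)=\sigma(1)$ and $C_k\subset S_k$ is the subgroup generated by the cyclic shift. The identity holds in the ring of finite sums of terms $f\,e^{n_1\theta(\xi_1)+\cdots+n_k\theta(\xi_k)}$, $n\in\mathbb Z^k$, with $f$ in the localization of $\mathcal B[[\xi_1^{-1},\dots,\xi_k^{-1}]]$ in which the $\xi_i^{-1}$ and the $\xi_i-\xi_j$ $(i\ne j)$ are invertible. -/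

import Mathlib

open scoped BigOperators

noncomputable section

namespace AKNS

universe u

/-! ### Time-dependent formal series

`𝓕` is a commutative `ℂ`-algebra of functions of `X` with a derivation `dX = ∂_X`. -/

/-- The ring `𝓕((ε))[[t_1, t_2, …]]`: power series in the times `t_{j+1}` (the `j`-th variable,
`j ≥ 0`) whose coefficients are formal Laurent series in `ε` over the functions of `X = t_0`. -/
abbrev TimeSeries (𝓕 : Type u) [CommRing 𝓕] : Type u :=
  MvPowerSeries ℕ (LaurentSeries 𝓕)

/-- The ring `𝓕((ε))[[t_1, t_2, …]]((ξ⁻¹))` of Laurent series in `ξ⁻¹`.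
The exponent of a term is the exponent of `ξ⁻¹`. -/
abbrev SpectralSeries (𝓕 : Type u) [CommRing 𝓕] : Type u :=
  LaurentSeries (TimeSeries 𝓕)

/-- The ring of finite sums `∑ₙ fₙ e^{nθ(ξ)}`, `n ∈ ℤ`, with `fₙ` Laurent series in `ξ⁻¹` and
`e^{θ(ξ)}` the formal exponential of `θ(ξ) = ε⁻¹ ∑_{k ≥ 0} 2^k t_k ξ^{k+1}`. -/
abbrev WaveRing (𝓕 : Type u) [CommRing 𝓕] : Type u :=
  AddMonoidAlgebra (SpectralSeries 𝓕) ℤ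

section Basic

variable {𝓕 : Type u} [CommRing 𝓕]

/-- The parameter `ε`. -/
def eps : TimeSeries 𝓕 := MvPowerSeries.C (HahnSeries.single (1 : ℤ) (1 : 𝓕))

/-- `ε⁻¹`. -/
def epsInv : TimeSeries 𝓕 := MvPowerSeries.C (HahnSeries.single (-1 : ℤ) (1 : 𝓕))

/-- The spectral parameter `ξ`. -/
def xi : SpectralSeries 𝓕 := HahnSeries.single (-1 : ℤ) (1 : TimeSeries 𝓕)

/-- The part of a Laurent series in `ξ⁻¹` that is polynomial in `ξ` (constant term included). -/
def polyPart (f : SpectralSeries 𝓕) : SpectralSeries 𝓕 := HahnSeries.truncLT (1 : ℤ) f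

/-- Series in `ξ⁻¹` as elements of the ring with formal exponentials. -/
def ofSpectral : SpectralSeries 𝓕 →+* WaveRing 𝓕 := AddMonoidAlgebra.singleZeroRingHom

/-- Series independent of `ξ` as elements of the ring with formal exponentials. -/
def ofTime : TimeSeries 𝓕 →+* WaveRing 𝓕 := ofSpectral.comp HahnSeries.C

variable [Algebra ℂ 𝓕] (dX : Derivation ℂ 𝓕 𝓕)

/-- `∂_X` acting coefficientwise on Laurent series in `ε`. -/
def dXLaurent : LaurentSeries 𝓕 →+ LaurentSeries 𝓕 where
  toFun f := f.map dX
  map_zero' := by ext; simp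
  map_add' f g := by ext; simp

/-- The derivations `∂/∂t_j`: for `j = 0` this is `∂_X` acting on the coefficients, for `j ≥ 1`
it is the formal partial derivative in the power series variable `t_j`. -/
def timeDeriv : ℕ → TimeSeries 𝓕 →+ TimeSeries 𝓕
  | 0 =>
    { toFun := fun f n => dXLaurent dX (MvPowerSeries.coeff n f)
      map_zero' := by funext n; exact map_zero (dXLaurent dX)
      map_add' := fun f g => by
        funext n; exact map_add (dXLaurent dX) (MvPowerSeries.coeff n f) (MvPowerSeries.coeff n g) }
  | j + 1 => (MvPowerSeries.pderiv (LaurentSeries 𝓕) j).toLinearMap.toAddMonoidHom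

/-- `∂/∂t_j` acting coefficientwise on Laurent series in `ξ⁻¹`. -/
def spectralDeriv (j : ℕ) (f : SpectralSeries 𝓕) : SpectralSeries 𝓕 := f.map (timeDeriv dX j)

/-- `∂/∂t_j` on the ring with formal exponentials:
`∂_j (f e^{nθ}) = (∂_j f + n ε⁻¹ 2^j ξ^{j+1} f) e^{nθ}`. -/
def waveDeriv (j : ℕ) (f : WaveRing 𝓕) : WaveRing 𝓕 :=
  f.coeff.sum fun n a => AddMonoidAlgebra.single n
    (spectralDeriv dX j a + (n : SpectralSeries 𝓕) * (HahnSeries.C epsInv * 2 ^ j * xi ^ (j + 1)) * a)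

/-! ### Matrix resolvent and hierarchy -/

/-- The coefficients `(A_n, B_n, C_n)` of the basic matrix resolvent, evaluated at `(q, r)`. -/
def resolventABC (q r : TimeSeries 𝓕) : ℕ → TimeSeries 𝓕 × TimeSeries 𝓕 × TimeSeries 𝓕
  | 0 => (0, q, -r)
  | k + 1 =>
    (-((1 / 2 : ℂ) • ∑ i : Fin (k + 1),
        ((resolventABC q r i).1 * (resolventABC q r (k - i)).1 +
          (resolventABC q r i).2.1 * (resolventABC q r (k - i)).2.2)),
      (1 / 2 : ℂ) • (eps * timeDeriv dX 0 (resolventABC q r k).2.1) + q * (resolventABC q r k).1,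
      -((1 / 2 : ℂ) • (eps * timeDeriv dX 0 (resolventABC q r k).2.2)) - r * (resolventABC q r k).1)
  decreasing_by all_goals omega

/-- The coefficient of `ξ⁻ⁿ` in the basic matrix resolvent. -/
def resolventCoeff (q r : TimeSeries 𝓕) : ℕ → Matrix (Fin 2) (Fin 2) (TimeSeries 𝓕)
  | 0 => !![2, 0; 0, 0]
  | n + 1 =>
    !![(resolventABC dX q r n).1, (resolventABC dX q r n).2.1;
      (resolventABC dX q r n).2.2, -(resolventABC dX q r n).1]

/-- The basic matrix resolvent `R(ξ) = ((2 + A, B), (C, -A))` with `A = ∑ A_n ξ^{-n-1}`,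
`B = ∑ B_n ξ^{-n-1}`, `C = ∑ C_n ξ^{-n-1}`; it is the unique series in
`diag(2, 0) + ξ⁻¹ Mat(2, ·)[[ξ⁻¹]]` that commutes with the Lax operator and satisfies
`tr R = 2`, `det R = 0`. -/
def basicResolvent (q r : TimeSeries 𝓕) : Matrix (Fin 2) (Fin 2) (SpectralSeries 𝓕) :=
  Matrix.of fun a b =>
    HahnSeries.ofPowerSeries ℤ (TimeSeries 𝓕) (PowerSeries.mk fun n => resolventCoeff dX q r n a b)

/-- `V_j(ξ) = (ξ^{j+1} R(ξ))₊`. -/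
def laxV (q r : TimeSeries 𝓕) (j : ℕ) : Matrix (Fin 2) (Fin 2) (SpectralSeries 𝓕) :=
  ((xi : SpectralSeries 𝓕) ^ (j + 1) • basicResolvent dX q r).map (polyPart (𝓕 := 𝓕))

/-- The matrix `U` of the Lax operator `L(ξ) = ε ∂_X + U`. -/
def laxU (q r : TimeSeries 𝓕) : Matrix (Fin 2) (Fin 2) (SpectralSeries 𝓕) :=
  !![-xi, -HahnSeries.C q; HahnSeries.C r, xi]

/-- `(q, r)` solves the hierarchy `∂L/∂t_j = 2^j ε⁻¹ [V_j, L]`, `j ≥ 0`, where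
`[V_j, ε ∂_X + U] = V_j U - U V_j - ε ∂_X V_j`. -/
def IsSolution (q r : TimeSeries 𝓕) : Prop :=
  ∀ j : ℕ, (laxU q r).map (spectralDeriv dX j) =
    (2 ^ j * HahnSeries.C epsInv : SpectralSeries 𝓕) •
      (laxV dX q r j * laxU q r - laxU q r * laxV dX q r j -
        (HahnSeries.C eps : SpectralSeries 𝓕) • (laxV dX q r j).map (spectralDeriv dX 0))

/-! ### Wave functions -/

/-- The vector `(ψ, (ε ψ_X - ξ ψ) / q)`. -/
def waveVector (q : TimeSeries 𝓕) (ψ : WaveRing 𝓕) : Fin 2 → WaveRing 𝓕 :=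
  ![ψ, ofTime (Ring.inverse q) * (ofTime eps * waveDeriv dX 0 ψ - ofSpectral xi * ψ)]

/-- `∂_k Ψ = ε⁻¹ 2^k (V_k(ξ) - ξ^{k+1} I) Ψ` for all `k ≥ 0`, with `Ψ` the vector of `ψ`. -/
def SatisfiesWaveEquations (q r : TimeSeries 𝓕) (ψ : WaveRing 𝓕) : Prop :=
  ∀ (k : ℕ) (a : Fin 2), waveDeriv dX k (waveVector dX q ψ a) =
    ofTime epsInv * 2 ^ k *
      (((laxV dX q r k - (xi : SpectralSeries 𝓕) ^ (k + 1) • (1 : Matrix (Fin 2) (Fin 2) (SpectralSeries 𝓕))).map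
        ofSpectral).mulVec (waveVector dX q ψ)) a

/-- Wave function of type A: `ψ_A = φ_A e^{θ(ξ)}` with `φ_A ∈ 1 + ξ⁻¹ 𝓕((ε))[[t]][[ξ⁻¹]]`. -/
def IsWaveA (q r : TimeSeries 𝓕) (ψ : WaveRing 𝓕) : Prop :=
  (∃ φ : PowerSeries (TimeSeries 𝓕), PowerSeries.constantCoeff φ = 1 ∧
    ψ = AddMonoidAlgebra.single 1 (HahnSeries.ofPowerSeries ℤ (TimeSeries 𝓕) φ)) ∧
  SatisfiesWaveEquations dX q r ψ

/-- Wave function of type B: `ψ_B = φ_B q e^{-θ(ξ)}` with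
`φ_B ∈ 1 + ξ⁻¹ 𝓕((ε))[[t]][[ξ⁻¹]]`. -/
def IsWaveB (q r : TimeSeries 𝓕) (ψ : WaveRing 𝓕) : Prop :=
  (∃ φ : PowerSeries (TimeSeries 𝓕), PowerSeries.constantCoeff φ = 1 ∧
    ψ = AddMonoidAlgebra.single (-1)
      (HahnSeries.ofPowerSeries ℤ (TimeSeries 𝓕) φ * HahnSeries.C q)) ∧
  SatisfiesWaveEquations dX q r ψ

/-- The pair condition `ε (ψ_A ψ_{B,X} - ψ_{A,X} ψ_B) / q = -2ξ`. -/
def IsPair (q : TimeSeries 𝓕) (ψA ψB : WaveRing 𝓕) : Prop :=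
  ofTime eps * (ψA * waveDeriv dX 0 ψB - waveDeriv dX 0 ψA * ψB) * ofTime (Ring.inverse q) =
    -2 * ofSpectral xi

end Basic

/-! ### Several spectral parameters -/

/-- The multiplicative set of power series in `z_0 = ξ_0⁻¹, …, z_{k-1} = ξ_{k-1}⁻¹` generated by
the `z_i` and the differences `z_i - z_j`, `i ≠ j`. -/
def denominators (𝓕 : Type u) [CommRing 𝓕] (k : ℕ) :
    Submonoid (MvPowerSeries (Fin k) (TimeSeries 𝓕)) :=
  Submonoid.closure
    ({z | ∃ i, z = MvPowerSeries.X i} ∪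
      {z | ∃ i j, i ≠ j ∧ z = MvPowerSeries.X i - MvPowerSeries.X j})

/-- `𝓕((ε))[[t]][[ξ_0⁻¹, …, ξ_{k-1}⁻¹]]` with the `ξ_i⁻¹` and the `ξ_i - ξ_j` (`i ≠ j`) inverted. -/
abbrev MultiSpectral (𝓕 : Type u) [CommRing 𝓕] (k : ℕ) : Type u :=
  Localization (denominators 𝓕 k)

/-- Finite sums of terms `f e^{n_0 θ(ξ_0) + ⋯ + n_{k-1} θ(ξ_{k-1})}` with `n ∈ ℤ^k`. -/
abbrev MultiWave (𝓕 : Type u) [CommRing 𝓕] (k : ℕ) : Type u :=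
  AddMonoidAlgebra (MultiSpectral 𝓕 k) (Fin k → ℤ)

section Multi

variable {𝓕 : Type u} [CommRing 𝓕]

/-- A power series in `ξ⁻¹` viewed as a series in `ξ_j⁻¹`. -/
def placePowerSeries {k : ℕ} (j : Fin k) :
    PowerSeries (TimeSeries 𝓕) →+* MultiSpectral 𝓕 k :=
  (algebraMap (MvPowerSeries (Fin k) (TimeSeries 𝓕)) (MultiSpectral 𝓕 k)).comp
    (MvPowerSeries.rename (R := TimeSeries 𝓕) (fun _ : Unit => j)).toRingHom

theorem placePowerSeries_X {k : ℕ} (j : Fin k) :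
    placePowerSeries (𝓕 := 𝓕) j PowerSeries.X =
      algebraMap (MvPowerSeries (Fin k) (TimeSeries 𝓕)) (MultiSpectral 𝓕 k)
        (MvPowerSeries.X j) := by
  simp [placePowerSeries, PowerSeries.X]

theorem isUnit_placePowerSeries {k : ℕ} (j : Fin k)
    (y : Submonoid.powers (PowerSeries.X : PowerSeries (TimeSeries 𝓕))) :
    IsUnit (placePowerSeries (𝓕 := 𝓕) j y) := by
  obtain ⟨_, n, rfl⟩ := y
  simp only [map_pow]
  refine IsUnit.pow n ?_
  rw [placePowerSeries_X]
  exact IsLocalization.map_units (MultiSpectral 𝓕 k)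
    (⟨MvPowerSeries.X j, Submonoid.subset_closure (Or.inl ⟨j, rfl⟩)⟩ : denominators 𝓕 k)

/-- The substitution `ξ ↦ ξ_j` on Laurent series in `ξ⁻¹`. -/
def place {k : ℕ} (j : Fin k) : SpectralSeries 𝓕 →+* MultiSpectral 𝓕 k :=
  IsLocalization.lift (M := Submonoid.powers (PowerSeries.X : PowerSeries (TimeSeries 𝓕)))
    (isUnit_placePowerSeries j)

/-- The substitution `ξ ↦ ξ_j` on the ring with formal exponentials: `f e^{nθ(ξ)}` is sent to
`f(ξ_j) e^{nθ(ξ_j)}`. -/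
def waveAt {k : ℕ} (j : Fin k) : WaveRing 𝓕 →+* MultiWave 𝓕 k :=
  (AddMonoidAlgebra.mapDomainRingHom (MultiSpectral 𝓕 k)
      (AddMonoidHom.single (fun _ : Fin k => ℤ) j)).comp
    (AddMonoidAlgebra.mapRingHom ℤ (place j))

/-- `ξ_j` in the ring with formal exponentials. -/
def xiAt {k : ℕ} (j : Fin k) : MultiWave 𝓕 k := waveAt j (ofSpectral xi)

/-- Power series in `ξ_0⁻¹, …, ξ_{k-1}⁻¹` as elements of the ring with formal exponentials. -/
def ofSeries {k : ℕ} : MvPowerSeries (Fin k) (TimeSeries 𝓕) →+* MultiWave 𝓕 k :=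
  AddMonoidAlgebra.singleZeroRingHom.comp (algebraMap _ (MultiSpectral 𝓕 k))

variable [Algebra ℂ 𝓕] (dX : Derivation ℂ 𝓕 𝓕)

/-- `D(ξ_i, ξ_j)`, to be used for `i ≠ j`:
`ε (ψ_A(ξ_i) ψ_{B,X}(ξ_j) - ψ_{A,X}(ξ_i) ψ_B(ξ_j)) / ((ξ_i - ξ_j) q) + ψ_A(ξ_i) ψ_B(ξ_j) / q`. -/
def kernelD (q : TimeSeries 𝓕) (ψA ψB : WaveRing 𝓕) {k : ℕ} (i j : Fin k) : MultiWave 𝓕 k :=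
  ofSeries (MvPowerSeries.C eps) *
      (waveAt i ψA * waveAt j (waveDeriv dX 0 ψB) - waveAt i (waveDeriv dX 0 ψA) * waveAt j ψB) *
      Ring.inverse (xiAt i - xiAt j) * ofSeries (MvPowerSeries.C (Ring.inverse q)) +
    waveAt i ψA * waveAt j ψB * ofSeries (MvPowerSeries.C (Ring.inverse q))

/-! ### Cyclic sums -/

theorem cyclicProd_eq {M : Type*} [CommMonoid M] {k : ℕ} (f : Fin k → Fin k → M)
    (σ τ : Equiv.Perm (Fin k))
    (h : QuotientGroup.leftRel (Subgroup.zpowers (finRotate k)) σ τ) :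
    ∏ j, f (σ (finRotate k j)) (σ j) = ∏ j, f (τ (finRotate k j)) (τ j) := by
  rw [QuotientGroup.leftRel_apply, Subgroup.mem_zpowers_iff] at h
  obtain ⟨m, hm⟩ := h
  have hτ : τ = σ * finRotate k ^ m := by rw [hm]; group
  have hc : ∀ j, (finRotate k ^ m) (finRotate k j) = finRotate k ((finRotate k ^ m) j) := by
    intro j
    rw [← Equiv.Perm.mul_apply, ← Equiv.Perm.mul_apply, ← zpow_add_one, ← zpow_one_add, add_comm]
  subst hτ
  simp only [Equiv.Perm.mul_apply, hc]
  exact (Equiv.prod_comp (finRotate k ^ m) fun j => f (σ (finRotate k j)) (σ j)).symm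

open Classical in
/-- `∑_{σ ∈ S_k / C_k} ∏_j f(σ(j+1), σ(j))`, the indices `j` being taken modulo `k`. -/
def cyclicSum {M : Type*} [CommRing M] {k : ℕ} (f : Fin k → Fin k → M) : M :=
  ∑ c : Equiv.Perm (Fin k) ⧸ Subgroup.zpowers (finRotate k),
    Quotient.liftOn' c (fun σ => ∏ j, f (σ (finRotate k j)) (σ j)) (cyclicProd_eq f)

/-! ### Tau-functions and correlation functions -/

/-- `Ω_{i_1,…,i_k} = ε^k ∂^k log τ / ∂t_{i_1} ⋯ ∂t_{i_k}`, in terms of `logτ = log τ`. -/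
def correlation (logτ : TimeSeries 𝓕) {k : ℕ} (i : Fin k → ℕ) : TimeSeries 𝓕 :=
  eps ^ k * (List.ofFn i).foldr (fun j f => timeDeriv dX j f) logτ

/-- The generating series `∑ Ω_{i_1,…,i_k} ∏_j 1 / (2^{i_j} ξ_j^{i_j + 2})`: the coefficient of
`∏ ξ_j^{-n_j}` is `2^{-∑(n_j - 2)} Ω_{n_1 - 2, …, n_k - 2}` if all `n_j ≥ 2`, and `0` otherwise. -/
def correlationSeries (logτ : TimeSeries 𝓕) (k : ℕ) : MvPowerSeries (Fin k) (TimeSeries 𝓕) :=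
  fun n => if ∀ j, 2 ≤ n j then
      (∏ j, (1 / 2 : ℂ) ^ (n j - 2)) • correlation dX logτ (fun j => n j - 2)
    else 0

/-- `τ` is a tau-function of the solution `(q, r)`:
`∑ Ω_{i,j} / (2^{i+j} ξ^{i+2} ν^{j+2}) = (tr R(ξ)R(ν) - 4) / (ξ - ν)²` holds with
`Ω_{i,j} = ε² ∂² log τ / ∂t_i ∂t_j`. -/
def IsLogTau (q r logτ : TimeSeries 𝓕) : Prop :=
  algebraMap _ (MultiSpectral 𝓕 2) (correlationSeries dX logτ 2) =
    (Matrix.trace ((basicResolvent dX q r).map (place (0 : Fin 2)) *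
        (basicResolvent dX q r).map (place (1 : Fin 2))) - 4) *
      Ring.inverse ((place (0 : Fin 2) xi - place (1 : Fin 2) xi) ^ 2)

end Multi

end AKNS

end

/-! Write `ψ_A = a e^θ` and `ψ_B = b e^{-θ}`, and let `u = (a, c)` and `v = (b/ξ, d)` be the power
series in `ξ⁻¹` for which the wave vectors are `u e^θ` and `ξ v e^{-θ}`. With `∧` the determinant on
`ℂ²`, the pair condition is `u ∧ v = -2`, and the resolvent is the rank-one matrix `R = -u ⊗ (v ∧
·)`. Thus `R u = 2u`, `R v = 0`, `tr R = 2`. The identification is made by checking the recursion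
for `A_n, B_n, C_n` (`resolventABC_eq`, `basicResolvent_eq`).

Since `V_p = ξ^{p+1} R - (ξ^{p+1} R)₋`, the exponentials remove the growing part of the wave
equations. Both `u` and `v` then satisfy `2^{-p} ε ∂_p x = -(ξ^{p+1} R)₋ x` (`exists_wavePairData`).

Let `∇ = ∑_p w^{p+2} 2^{-p} ε ∂_p`, with `w = ξ_0⁻¹` a new variable and the old indices shifted by
one. It sends the `k`-point series to the `(k+1)`-point series (`insertion_correlationSeries`). Put
`E(i,j) = u(ξ_i) ∧ v(ξ_j) / (ξ_i - ξ_j)`. Summing the flow as a geometric series gives `∇E(i,j) =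
E(i,0) E(0,j) + (γ_j - γ_i) E(i,j)` (`derivation_wedgeKernel`). Around a cycle the `γ` terms
telescope, so `∇` of a cyclic product is the sum over all ways of inserting the point `0` into the
cycle. Summed over cycles, this produces every longer cycle once (`derivation_permSum`,
`permSum_succ`).

For `k = 2` the formula is the tau-function equation with the rank-one `R` substituted
(`toLoc_correlationSeries_two`). Its extra term `4/(ξ_1 - ξ_2)²` has constant coefficients, so `∇`
kills it, and induction on `k` follows (`toLoc_eq_neg_cyclicSum`). Finally `D(ξ_i, ξ_j) = ξ_j
e^{θ(ξ_i) - θ(ξ_j)} E(i,j)` (`kernelD_eq`). Along a cycle the exponentials cancel and the factors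
`ξ_j` account for the prefactor. -/

noncomputable section

namespace AKNS

universe u

/-! ### Coefficientwise derivations of power series. -/

section CoefficientDerivation

variable {T : Type u} [CommRing T] {σ ι : Type*}

/-- A derivation of the coefficient ring, acting coefficientwise on power series. -/
def coeffDeriv (σ : Type*) (δ : Derivation ℤ T T) :
    Derivation ℤ (MvPowerSeries σ T) (MvPowerSeries σ T) :=
  Derivation.mk'
    { toFun := fun s n => δ (MvPowerSeries.coeff n s)
      map_add' := fun s t => by
        funext n
        exact (congrArg δ (map_add _ s t)).trans (map_add δ _ _)
      map_smul' := fun c s => by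
        funext n
        exact (congrArg δ (map_zsmul (MvPowerSeries.coeff n) c s)).trans (map_zsmul δ _ _) }
    (fun s t => by
      classical
      ext n
      change δ (MvPowerSeries.coeff n (s * t)) = MvPowerSeries.coeff n (s * _ + t * _)
      rw [map_add, mul_comm t, MvPowerSeries.coeff_mul, MvPowerSeries.coeff_mul,
        MvPowerSeries.coeff_mul, map_sum, ← Finset.sum_add_distrib]
      refine Finset.sum_congr rfl fun p _ => ?_
      rw [Derivation.leibniz, smul_eq_mul, smul_eq_mul, mul_comm (MvPowerSeries.coeff p.2 t)]
      rfl)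

theorem coeff_coeffDeriv (δ : Derivation ℤ T T) (s : MvPowerSeries σ T) (n : σ →₀ ℕ) :
    MvPowerSeries.coeff n (coeffDeriv σ δ s) = δ (MvPowerSeries.coeff n s) := rfl

theorem powerSeries_coeff_coeffDeriv (δ : Derivation ℤ T T) (s : PowerSeries T) (n : ℕ) :
    PowerSeries.coeff n (coeffDeriv Unit δ s) = δ (PowerSeries.coeff n s) := rfl

theorem coeffDeriv_mul (δ : Derivation ℤ T T) (s t : MvPowerSeries σ T) :
    coeffDeriv σ δ (s * t) = s * coeffDeriv σ δ t + t * coeffDeriv σ δ s :=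
  Derivation.leibniz _ _ _

theorem coeffDeriv_rename (f : σ → ι) [Filter.TendstoCofinite f] (δ : Derivation ℤ T T)
    (s : MvPowerSeries σ T) :
    coeffDeriv ι δ (MvPowerSeries.rename f s) = MvPowerSeries.rename f (coeffDeriv σ δ s) := by
  ext n
  simp only [coeff_coeffDeriv, MvPowerSeries.coeff_rename, map_sum]

theorem coeffDeriv_C (δ : Derivation ℤ T T) (a : T) :
    coeffDeriv σ δ (MvPowerSeries.C a) = MvPowerSeries.C (δ a) := by
  classical
  ext n
  rw [coeff_coeffDeriv, MvPowerSeries.coeff_C, MvPowerSeries.coeff_C]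
  split_ifs <;> simp

theorem coeffDeriv_X (δ : Derivation ℤ T T) (i : σ) :
    coeffDeriv σ δ (MvPowerSeries.X i : MvPowerSeries σ T) = 0 := by
  classical
  ext n
  rw [coeff_coeffDeriv, MvPowerSeries.coeff_X]
  split_ifs <;> simp

end CoefficientDerivation

/-! ### The insertion operator, adding one spectral variable. -/

section Insertion

variable {T : Type u} [CommRing T] {k : ℕ}

theorem finSuccEquiv_rename_succ (s : MvPowerSeries (Fin k) T) :
    MvPowerSeries.finSuccEquiv T k (MvPowerSeries.rename Fin.succ s) = PowerSeries.C s := by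
  classical
  ext p m
  rw [MvPowerSeries.coeff_coeff_finSuccEquiv, PowerSeries.coeff_C]
  split_ifs with hp
  · subst hp
    have h : Finsupp.cons 0 m = Finsupp.embDomain (Fin.succEmb k) m := by
      ext i
      refine Fin.cases ?_ (fun i => ?_) i
      · rw [Finsupp.cons_zero, Finsupp.embDomain_of_notMem_range]
        simp
      · rw [Finsupp.cons_succ]
        exact (Finsupp.embDomain_apply_self (Fin.succEmb k) m i).symm
    rw [h]
    exact MvPowerSeries.coeff_embDomain_rename (Fin.succEmb k) s m
  · rw [map_zero]
    refine MvPowerSeries.coeff_rename_eq_zero _ _ ?_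
    rintro ⟨x, hx⟩
    apply hp
    have := DFunLike.congr_fun hx 0
    rw [Finsupp.cons_zero, Finsupp.mapDomain_of_notMem_range] at this
    · exact this.symm
    · simp

theorem finSuccEquiv_rename_zero (s : PowerSeries T) :
    MvPowerSeries.finSuccEquiv T k (MvPowerSeries.rename (fun _ : Unit => (0 : Fin (k + 1))) s) =
      PowerSeries.map MvPowerSeries.C s := by
  classical
  ext p m
  rw [MvPowerSeries.coeff_coeff_finSuccEquiv, PowerSeries.coeff_map, MvPowerSeries.coeff_C]
  let e : Unit ↪ Fin (k + 1) := ⟨fun _ => 0, fun _ _ _ => rfl⟩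
  split_ifs with hm
  · subst hm
    have h : Finsupp.cons p (0 : Fin k →₀ ℕ) = Finsupp.embDomain e (Finsupp.single () p) := by
      rw [Finsupp.embDomain_single]
      change _ = Finsupp.single (0 : Fin (k + 1)) p
      ext i
      refine Fin.cases ?_ (fun i => ?_) i
      · simp
      · simp
    rw [h]
    exact MvPowerSeries.coeff_embDomain_rename e s _
  · refine MvPowerSeries.coeff_rename_eq_zero _ _ ?_
    rintro ⟨x, hx⟩
    apply hm
    ext i
    have := DFunLike.congr_fun hx i.succ
    rw [Finsupp.cons_succ, Finsupp.mapDomain_of_notMem_range] at this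
    · exact this.symm
    · simp

/-- `∑_{p ≥ 0} w^{p+2} D_p`, with `w` the variable of index `0` of the target. -/
def insertion (D : ℕ → Derivation ℤ T T) (s : MvPowerSeries (Fin k) T) :
    MvPowerSeries (Fin (k + 1)) T :=
  (MvPowerSeries.finSuccEquiv T k).symm
    (PowerSeries.mk fun p => if 2 ≤ p then coeffDeriv (Fin k) (D (p - 2)) s else 0)

theorem finSuccEquiv_insertion (D : ℕ → Derivation ℤ T T) (s : MvPowerSeries (Fin k) T) :
    MvPowerSeries.finSuccEquiv T k (insertion D s) =
      PowerSeries.mk fun p => if 2 ≤ p then coeffDeriv (Fin k) (D (p - 2)) s else 0 :=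
  AlgEquiv.apply_symm_apply _ _

theorem coeff_insertion (D : ℕ → Derivation ℤ T T) (s : MvPowerSeries (Fin k) T)
    (n : Fin (k + 1) →₀ ℕ) :
    MvPowerSeries.coeff n (insertion D s) =
      if 2 ≤ n 0 then D (n 0 - 2) (MvPowerSeries.coeff n.tail s) else 0 := by
  have h := MvPowerSeries.coeff_coeff_finSuccEquiv (R := T) (n := k) (insertion D s)
    (k := n 0) (x := n.tail)
  rw [Finsupp.cons_tail, finSuccEquiv_insertion, PowerSeries.coeff_mk] at h
  rw [← h]
  split_ifs
  · rfl
  · exact map_zero _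

theorem insertion_add (D : ℕ → Derivation ℤ T T) (s t : MvPowerSeries (Fin k) T) :
    insertion D (s + t) = insertion D s + insertion D t := by
  ext n
  rw [map_add]
  simp only [coeff_insertion]
  split_ifs <;> simp

/-- Viewed as a power series in the new variable, a shifted series is constant, so the Leibniz rule
for each `D p` can be read off coefficient by coefficient. Source and target are different rings, so
it is a Leibniz rule along the index shift. -/
theorem insertion_mul (D : ℕ → Derivation ℤ T T) (s t : MvPowerSeries (Fin k) T) :
    insertion D (s * t) = MvPowerSeries.rename Fin.succ s * insertion D t +
      MvPowerSeries.rename Fin.succ t * insertion D s := by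
  apply (MvPowerSeries.finSuccEquiv T k).injective
  rw [map_add, map_mul, map_mul, finSuccEquiv_rename_succ, finSuccEquiv_rename_succ]
  simp only [finSuccEquiv_insertion]
  refine PowerSeries.ext fun p => ?_
  rw [map_add, PowerSeries.coeff_C_mul, PowerSeries.coeff_C_mul]
  simp only [PowerSeries.coeff_mk]
  split_ifs
  · rw [Derivation.leibniz, smul_eq_mul, smul_eq_mul]
  · simp

theorem insertion_one (D : ℕ → Derivation ℤ T T) :
    insertion D (1 : MvPowerSeries (Fin k) T) = 0 := by
  have h := insertion_mul D (1 : MvPowerSeries (Fin k) T) 1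
  rw [mul_one, map_one, one_mul] at h
  simpa using h

theorem insertion_X (D : ℕ → Derivation ℤ T T) (i : Fin k) :
    insertion D (MvPowerSeries.X i : MvPowerSeries (Fin k) T) = 0 := by
  apply (MvPowerSeries.finSuccEquiv T k).injective
  rw [finSuccEquiv_insertion, map_zero]
  refine PowerSeries.ext fun p => ?_
  simp [coeffDeriv_X]

end Insertion

/-! ### Extension to localizations -/

/-- A derivation along a ring homomorphism which inverts `M` extends to the localization at `M`. -/
theorem exists_derivation_along_lift {A A' B : Type*} [CommRing A] [CommRing A'] [CommRing B]
    [Algebra A A'] (M : Submonoid A) [IsLocalization M A'] (f : A →+* B)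
    (hf : ∀ y : M, IsUnit (f y)) (δ : A →+ B) (h1 : δ 1 = 0)
    (hmul : ∀ x y, δ (x * y) = f x * δ y + f y * δ x) :
    ∃ δ' : A' →+ B, (∀ x, δ' (algebraMap A A' x) = δ x) ∧
      ∀ x y, δ' (x * y) = IsLocalization.lift (S := A') hf x * δ' y +
        IsLocalization.lift (S := A') hf y * δ' x := by
  let g : A →+* TrivSqZeroExt B B :=
    { toFun := fun s => TrivSqZeroExt.inl (f s) + TrivSqZeroExt.inr (δ s)
      map_zero' := by simp
      map_one' := by simp [h1]
      map_add' := fun s t => by ext <;> simp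
      map_mul' := fun s t => by
        ext
        · simp
        · simp [hmul, mul_comm] }
  have hg : ∀ y : M, IsUnit (g y) := fun y =>
    TrivSqZeroExt.isUnit_iff_isUnit_fst.2 (by simpa [g] using hf y)
  let G : A' →+* TrivSqZeroExt B B := IsLocalization.lift hg
  have hG : ∀ x, G (algebraMap A A' x) = g x := fun x => IsLocalization.lift_eq hg x
  have hfst : ∀ x, (G x).fst = IsLocalization.lift (S := A') hf x := by
    let F : A' →+* B := (TrivSqZeroExt.fstHom B B B).toRingHom.comp G
    have hF : F = IsLocalization.lift (S := A') hf := by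
      refine IsLocalization.ringHom_ext M (RingHom.ext fun x => ?_)
      change (G (algebraMap A A' x)).fst = IsLocalization.lift (S := A') hf (algebraMap A A' x)
      rw [hG, IsLocalization.lift_eq]
      simp [g]
    exact fun x => DFunLike.congr_fun hF x
  refine ⟨{ toFun := fun x => (G x).snd, map_zero' := by simp, map_add' := by simp },
    fun x => ?_, fun x y => ?_⟩
  · change (G (algebraMap A A' x)).snd = _
    rw [hG]
    simp [g]
  · change (G (x * y)).snd = _ * (G y).snd + _ * (G x).snd
    rw [map_mul, TrivSqZeroExt.snd_mul, ← hfst, ← hfst]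
    simp only [smul_eq_mul, MulOpposite.smul_eq_mul_unop, MulOpposite.unop_op]
    rw [mul_comm (G x).snd]

/-- The multiplicative set generated by the variables and their differences. -/
def differenceSubmonoid (T : Type u) [CommRing T] (k : ℕ) : Submonoid (MvPowerSeries (Fin k) T) :=
  Submonoid.closure
    ({z | ∃ i, z = MvPowerSeries.X i} ∪
      {z | ∃ i j, i ≠ j ∧ z = MvPowerSeries.X i - MvPowerSeries.X j})

/-- Power series with the variables and their differences inverted. -/
abbrev DifferenceLocalization (T : Type u) [CommRing T] (k : ℕ) : Type u :=
  Localization (differenceSubmonoid T k)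

section Localization

variable {T : Type u} [CommRing T] {k : ℕ}

/-- The structure map to the localization. -/
abbrev toLoc : MvPowerSeries (Fin k) T →+* DifferenceLocalization T k := algebraMap _ _

theorem isUnit_toLoc_X (i : Fin k) :
    IsUnit (toLoc (MvPowerSeries.X i : MvPowerSeries (Fin k) T)) :=
  IsLocalization.map_units (DifferenceLocalization T k)
    (⟨MvPowerSeries.X i, Submonoid.subset_closure (Or.inl ⟨i, rfl⟩)⟩ : differenceSubmonoid T k)

theorem isUnit_toLoc_X_sub_X {i j : Fin k} (h : i ≠ j) :
    IsUnit (toLoc (MvPowerSeries.X i - MvPowerSeries.X j : MvPowerSeries (Fin k) T)) :=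
  IsLocalization.map_units (DifferenceLocalization T k)
    (⟨MvPowerSeries.X i - MvPowerSeries.X j,
      Submonoid.subset_closure (Or.inr ⟨i, j, h, rfl⟩)⟩ : differenceSubmonoid T k)

theorem isUnit_toLoc_rename_succ (y : differenceSubmonoid T k) :
    IsUnit (toLoc (MvPowerSeries.rename Fin.succ (y : MvPowerSeries (Fin k) T))) := by
  obtain ⟨y, hy⟩ := y
  induction hy using Submonoid.closure_induction with
  | mem x hx =>
    rcases hx with ⟨i, rfl⟩ | ⟨i, j, hij, rfl⟩
    · simpa using isUnit_toLoc_X i.succ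
    · have := isUnit_toLoc_X_sub_X (T := T) (i := i.succ) (j := j.succ) (by simpa using hij)
      simpa using this
  | one => simp
  | mul x y _ _ hx hy => simpa using hx.mul hy

/-- The homomorphism of localizations which shifts the indices of the variables by one. -/
def shiftLoc : DifferenceLocalization T k →+* DifferenceLocalization T (k + 1) :=
  IsLocalization.lift (M := differenceSubmonoid T k)
    (g := toLoc.comp (MvPowerSeries.rename (R := T) (Fin.succ (n := k))).toRingHom)
    isUnit_toLoc_rename_succ

theorem shiftLoc_toLoc (s : MvPowerSeries (Fin k) T) :
    shiftLoc (toLoc s) = toLoc (MvPowerSeries.rename Fin.succ s) :=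
  IsLocalization.lift_eq _ _

theorem exists_insertLoc (D : ℕ → Derivation ℤ T T) :
    ∃ δ : DifferenceLocalization T k →+ DifferenceLocalization T (k + 1),
      (∀ s, δ (toLoc s) = toLoc (insertion D s)) ∧
        ∀ x y, δ (x * y) = shiftLoc x * δ y + shiftLoc y * δ x :=
  exists_derivation_along_lift (differenceSubmonoid T k)
    (toLoc.comp (MvPowerSeries.rename (R := T) (Fin.succ (n := k))).toRingHom)
    isUnit_toLoc_rename_succ
    (toLoc.toAddMonoidHom.comp
      { toFun := insertion D
        map_zero' := by simpa using insertion_add D (0 : MvPowerSeries (Fin k) T) 0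
        map_add' := insertion_add D })
    (by
      change toLoc (insertion D 1) = 0
      rw [insertion_one, map_zero])
    (fun x y => by
      change toLoc (insertion D (x * y)) = toLoc _ * toLoc _ + toLoc _ * toLoc _
      rw [insertion_mul, map_add, map_mul, map_mul]
      rfl)

end Localization

/-! ### Sums over permutations of cyclic products -/

section CyclicSums

variable {M : Type*} [CommRing M]

/-- `∑_{σ ∈ S_k} ∏_j f(σ(j+1), σ(j))`. -/
def permSum {k : ℕ} (f : Fin k → Fin k → M) : M :=
  ∑ σ : Equiv.Perm (Fin k), ∏ j, f (σ (finRotate k j)) (σ j)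

/-- Every coset of the cyclic group has `k` elements, since `finRotate k` is a full cycle, and the
product is constant on each. Sums over all permutations replace sums over cosets from here on, at
the price of a factor that is later cancelled. -/
theorem nsmul_cyclicSum {k : ℕ} (hk : 2 ≤ k) (f : Fin k → Fin k → M) :
    k • cyclicSum f = permSum f := by
  classical
  have hcard : Fintype.card (Subgroup.zpowers (finRotate k)) = k := by
    obtain ⟨n, rfl⟩ : ∃ n, k = n + 2 := ⟨k - 2, by omega⟩
    rw [Fintype.card_zpowers, (isCycle_finRotate).orderOf, support_finRotate]
    simp
  let e := Subgroup.groupEquivQuotientProdSubgroup (s := Subgroup.zpowers (finRotate k))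
  rw [permSum, ← Equiv.sum_comp e.symm, Fintype.sum_prod_type, cyclicSum, Finset.smul_sum]
  refine Finset.sum_congr (by congr!) fun c _ => ?_
  have hc : ∀ h, (∏ j, f (e.symm (c, h) (finRotate k j)) (e.symm (c, h) j)) =
      Quotient.liftOn' c (fun σ : Equiv.Perm (Fin k) => ∏ j, f (σ (finRotate k j)) (σ j))
        (cyclicProd_eq f) := by
    intro h
    have : c = QuotientGroup.mk (e.symm (c, h)) := by
      have h1 : (e (e.symm (c, h))).1 = c := by rw [Equiv.apply_symm_apply]
      rw [← h1]
      simp only [Equiv.apply_symm_apply]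
      exact h1.symm.trans rfl
    conv_rhs => rw [this]
    rfl
  rw [Finset.sum_congr rfl fun h _ => hc h, Finset.sum_const, Finset.card_univ, hcard]

/-- The product over the cycle `σ` with the index `0` inserted between `σ(j)` and `σ(j+1)`; the
original indices are shifted by one. -/
def insertedProd {n : ℕ} (f : Fin (n + 1) → Fin (n + 1) → M) (σ : Equiv.Perm (Fin n))
    (j : Fin n) : M :=
  f (σ (finRotate n j)).succ 0 * f 0 (σ j).succ *
    ∏ l ∈ Finset.univ.erase j, f (σ (finRotate n l)).succ (σ l).succ

/-- Relabelling the positions by a map that commutes with rotation only moves the place of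
insertion. -/
theorem insertedProd_mul {n : ℕ} (f : Fin (n + 1) → Fin (n + 1) → M)
    (σ c : Equiv.Perm (Fin n)) (hc : ∀ l, c (finRotate n l) = finRotate n (c l)) (j : Fin n) :
    insertedProd f (σ * c) j = insertedProd f σ (c j) := by
  classical
  unfold insertedProd
  simp only [Equiv.Perm.mul_apply, hc]
  congr 1
  refine Finset.prod_nbij' c c.symm ?_ ?_ ?_ ?_ ?_ <;> simp [Equiv.symm_apply_eq]

theorem addRight_finRotate {n : ℕ} (a l : Fin (n + 1)) :
    Equiv.addRight a (finRotate (n + 1) l) = finRotate (n + 1) (Equiv.addRight a l) := by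
  simp only [finRotate_apply, Equiv.coe_addRight]
  abel

theorem sum_insertedProd {n : ℕ} (f : Fin (n + 2) → Fin (n + 2) → M) :
    ∑ σ : Equiv.Perm (Fin (n + 1)), ∑ j, insertedProd f σ j =
      (n + 1) • ∑ σ : Equiv.Perm (Fin (n + 1)), insertedProd f σ (Fin.last n) := by
  have h : ∀ j : Fin (n + 1), ∑ σ : Equiv.Perm (Fin (n + 1)), insertedProd f σ j =
      ∑ σ : Equiv.Perm (Fin (n + 1)), insertedProd f σ (Fin.last n) := by
    intro j
    conv_rhs => rw [← Equiv.sum_comp (Equiv.mulRight (Equiv.addRight (j - Fin.last n)))]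
    refine Finset.sum_congr rfl fun σ _ => ?_
    rw [Equiv.coe_mulRight, insertedProd_mul f σ _ (addRight_finRotate _)]
    change _ = insertedProd f σ (Fin.last n + (j - Fin.last n))
    rw [add_sub_cancel]
  rw [Finset.sum_comm, Finset.sum_congr rfl fun j _ => h j, Finset.sum_const, Finset.card_univ,
    Fintype.card_fin]

/-- The position of the value `0` can be rotated to position `0`, which gives the factor `n + 2`. A
permutation fixing `0` is a permutation of the other points, and `0` sits between the last and the
first of them. -/
theorem permSum_succ {n : ℕ} (f : Fin (n + 2) → Fin (n + 2) → M) :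
    permSum f = (n + 2) • ∑ σ : Equiv.Perm (Fin (n + 1)), insertedProd f σ (Fin.last n) := by
  classical
  have hinv : ∀ (σ : Equiv.Perm (Fin (n + 2))) (a : Fin (n + 2)),
      (∏ j, f ((σ * Equiv.addRight a) (finRotate _ j)) ((σ * Equiv.addRight a) j)) =
        ∏ j, f (σ (finRotate _ j)) (σ j) := by
    intro σ a
    simp only [Equiv.Perm.mul_apply, addRight_finRotate]
    exact Equiv.prod_comp (Equiv.addRight a) fun j => f (σ (finRotate _ j)) (σ j)
  have hsplit : permSum f = ∑ p : Fin (n + 2), ∑ σ : Equiv.Perm (Fin (n + 2)),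
      if σ p = 0 then ∏ j, f (σ (finRotate _ j)) (σ j) else 0 := by
    rw [Finset.sum_comm, permSum]
    refine Finset.sum_congr rfl fun σ _ => ?_
    have : ∀ p, σ p = 0 ↔ p = σ.symm 0 := fun p => (Equiv.eq_symm_apply σ).symm
    simp only [this, Finset.sum_ite_eq', Finset.mem_univ, if_true]
  have hzero : ∀ p : Fin (n + 2), (∑ σ : Equiv.Perm (Fin (n + 2)),
      if σ p = 0 then ∏ j, f (σ (finRotate _ j)) (σ j) else 0) =
      ∑ σ : Equiv.Perm (Fin (n + 2)),
        if σ 0 = 0 then ∏ j, f (σ (finRotate _ j)) (σ j) else 0 := by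
    intro p
    conv_rhs => rw [← Equiv.sum_comp (Equiv.mulRight (Equiv.addRight p))]
    refine Finset.sum_congr rfl fun σ _ => ?_
    rw [Equiv.coe_mulRight, hinv]
    simp
  rw [hsplit, Finset.sum_congr rfl fun p _ => hzero p, Finset.sum_const, Finset.card_univ,
    Fintype.card_fin]
  congr 1
  -- `decomposeFin` parametrizes permutations by the image of `0` and a permutation of the rest;
  -- only image `0` contributes.
  rw [← Equiv.sum_comp Equiv.Perm.decomposeFin.symm, Fintype.sum_prod_type, Finset.sum_eq_single 0]
  · refine Finset.sum_congr rfl fun e _ => ?_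
    rw [Equiv.Perm.decomposeFin_symm_apply_zero, if_pos rfl]
    have hs : ∀ x : Fin (n + 1), Equiv.Perm.decomposeFin.symm ((0 : Fin (n + 2)), e) x.succ =
        (e x).succ := fun x => by
      rw [Equiv.Perm.decomposeFin_symm_apply_succ, Equiv.swap_self, Equiv.refl_apply]
    rw [Fin.prod_univ_succ, Fin.prod_univ_castSucc, insertedProd]
    have h0 : finRotate (n + 2) 0 = Fin.succ 0 := by simp
    have hl : finRotate (n + 2) (Fin.last n).succ = 0 := by
      rw [Fin.succ_last, finRotate_last]
    have hj : ∀ j : Fin n, finRotate (n + 2) j.castSucc.succ = Fin.succ j.succ := by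
      intro j
      rw [finRotate_apply, Fin.succ_castSucc, Fin.coeSucc_eq_succ]
    have hj' : ∀ j : Fin n, finRotate (n + 1) j.castSucc = j.succ := by
      intro j
      simp
    rw [h0, hl, Equiv.Perm.decomposeFin_symm_apply_zero]
    simp only [hj, hs]
    rw [finRotate_last]
    have hprod : ∏ l ∈ Finset.univ.erase (Fin.last n),
        f (e (finRotate (n + 1) l)).succ (e l).succ =
        ∏ j : Fin n, f (e j.succ).succ (e j.castSucc).succ := by
      have herase : Finset.univ.erase (Fin.last n) = Finset.univ.map Fin.castSuccEmb := by
        ext x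
        simp [Fin.exists_castSucc_eq]
      rw [herase, Finset.prod_map]
      simp
    rw [hprod]
    ring
  · intro p _ hp
    refine Finset.sum_eq_zero fun e _ => ?_
    rw [Equiv.Perm.decomposeFin_symm_apply_zero, if_neg hp]
  · simp

end CyclicSums

/-! ### Generating series of the flows and the variation of the wedge kernel. -/

section Kernel

variable {T : Type u} [CommRing T] {k : ℕ}

/-- The part of `ξ^{k+1} s` with negative powers of `ξ`, for a power series `s` in `ξ⁻¹`. -/
def negPart (k : ℕ) (s : PowerSeries T) : PowerSeries T :=
  PowerSeries.mk fun m => if m = 0 then 0 else PowerSeries.coeff (k + 1 + m) s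

/-- Dividing by `ξ` moves from one power to the previous one and loses just the `ξ⁻¹` term. These
recursions make the sum over `k` telescope in `X_sub_X_mul_negPartSeries`. -/
theorem X_mul_negPart_succ (k : ℕ) (s : PowerSeries T) :
    PowerSeries.X * negPart (k + 1) s =
      negPart k s - PowerSeries.C (PowerSeries.coeff (k + 2) s) * PowerSeries.X := by
  ext m
  rcases m with _ | _ | m
  · simp [negPart]
  · simp [negPart, PowerSeries.coeff_succ_X_mul]
  · rw [PowerSeries.coeff_succ_X_mul, map_sub, PowerSeries.coeff_C_mul, PowerSeries.coeff_X]
    simp only [negPart, PowerSeries.coeff_mk]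
    simp
    congr 1
    congr 1
    omega

theorem X_mul_negPart_zero (s : PowerSeries T) :
    PowerSeries.X * negPart 0 s =
      s - PowerSeries.C (PowerSeries.coeff 0 s) -
        PowerSeries.C (PowerSeries.coeff 1 s) * PowerSeries.X := by
  ext m
  rcases m with _ | _ | m
  · simp [negPart]
  · simp [negPart, PowerSeries.coeff_C]
  · rw [PowerSeries.coeff_succ_X_mul, map_sub, map_sub, PowerSeries.coeff_C_mul,
      PowerSeries.coeff_X, PowerSeries.coeff_C]
    simp only [negPart, PowerSeries.coeff_mk]
    simp
    congr 1
    congr 1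
    omega

/-- A power series in one variable as a series in the variable of index `j`. -/
abbrev seriesAt (j : Fin k) : PowerSeries T →ₐ[T] MvPowerSeries (Fin k) T :=
  MvPowerSeries.rename (fun _ : Unit => j)

theorem seriesAt_X (j : Fin k) :
    seriesAt j (PowerSeries.X : PowerSeries T) = MvPowerSeries.X j :=
  MvPowerSeries.rename_X _ _

theorem seriesAt_C (j : Fin k) (t : T) :
    seriesAt j (PowerSeries.C t) = MvPowerSeries.C t :=
  MvPowerSeries.rename_C _ _

theorem rename_succ_seriesAt (j : Fin k) (s : PowerSeries T) :
    MvPowerSeries.rename Fin.succ (seriesAt j s) = seriesAt j.succ s :=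
  MvPowerSeries.rename_rename _ _ _

/-- `∑_{p ≥ 0} w^{p+2} (ξ_i^{p+1} s(ξ_i))₋`, with `w` the variable of index `0`. -/
def negPartSeries (s : PowerSeries T) (i : Fin k) : MvPowerSeries (Fin (k + 1)) T :=
  (MvPowerSeries.finSuccEquiv T k).symm
    (PowerSeries.mk fun p => if 2 ≤ p then seriesAt i (negPart (p - 2) s) else 0)

/-- Multiplication by `w - z`, with `z = ξ_i⁻¹`, telescopes the series by the recursion for
`negPart`. Up to a correction by the constant term of `s`, the result is the difference quotient of
`s` between `w` and `z`, which brings in the value of `s` at the new point. -/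
theorem X_sub_X_mul_negPartSeries (s : PowerSeries T) (i : Fin k) :
    (MvPowerSeries.X 0 - MvPowerSeries.X i.succ) * negPartSeries s i =
      MvPowerSeries.X 0 * (MvPowerSeries.X i.succ * seriesAt 0 s -
        MvPowerSeries.X 0 * seriesAt i.succ s) +
      MvPowerSeries.X 0 * (MvPowerSeries.X 0 - MvPowerSeries.X i.succ) *
        MvPowerSeries.C (PowerSeries.coeff 0 s) := by
  apply (MvPowerSeries.finSuccEquiv T k).injective
  have h2 : MvPowerSeries.finSuccEquiv T k (seriesAt i.succ s) = PowerSeries.C (seriesAt i s) := by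
    rw [← rename_succ_seriesAt, finSuccEquiv_rename_succ]
  simp only [map_mul, map_add, map_sub, MvPowerSeries.finSuccEquiv_X_zero,
    MvPowerSeries.finSuccEquiv_X_succ, MvPowerSeries.finSuccEquiv_C, h2]
  rw [finSuccEquiv_rename_zero, negPartSeries, AlgEquiv.apply_symm_apply]
  have e0 : MvPowerSeries.X i * seriesAt i (negPart 0 s) = seriesAt i s -
      MvPowerSeries.C (PowerSeries.coeff 0 s) -
        MvPowerSeries.C (PowerSeries.coeff 1 s) * MvPowerSeries.X i := by
    rw [← seriesAt_X, ← map_mul, X_mul_negPart_zero]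
    simp only [map_mul, map_sub, seriesAt_X, seriesAt_C]
  have e1 : ∀ p, MvPowerSeries.X i * seriesAt i (negPart (p + 1) s) =
      seriesAt i (negPart p s) -
        MvPowerSeries.C (PowerSeries.coeff (p + 2) s) * MvPowerSeries.X i := by
    intro p
    rw [← seriesAt_X, ← map_mul, X_mul_negPart_succ]
    simp only [map_mul, map_sub, seriesAt_X, seriesAt_C]
  refine PowerSeries.ext fun p => ?_
  rw [sub_mul, map_sub, PowerSeries.coeff_C_mul, map_add, mul_assoc PowerSeries.X]
  rcases p with _ | _ | _ | p
  · simp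
  · have h3 : PowerSeries.constantCoeff (PowerSeries.map
        (MvPowerSeries.C : T →+* MvPowerSeries (Fin k) T) s) =
        MvPowerSeries.C (PowerSeries.constantCoeff s) := by
      rw [← PowerSeries.coeff_zero_eq_constantCoeff_apply, PowerSeries.coeff_map,
        PowerSeries.coeff_zero_eq_constantCoeff_apply]
    simp [PowerSeries.coeff_succ_X_mul, mul_comm, h3]
  · simp only [PowerSeries.coeff_succ_X_mul, sub_mul, map_sub, PowerSeries.coeff_C_mul,
      PowerSeries.coeff_mk, PowerSeries.coeff_map, PowerSeries.coeff_C]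
    simp [e0]
    ring
  · simp only [PowerSeries.coeff_succ_X_mul, sub_mul, map_sub, PowerSeries.coeff_C_mul,
      PowerSeries.coeff_mk, PowerSeries.coeff_map, PowerSeries.coeff_C]
    simp [e1]
    ring

theorem insertion_seriesAt (D : ℕ → Derivation ℤ T T) {s x y r₁ r₂ : PowerSeries T}
    (h : ∀ p, coeffDeriv Unit (D p) s = -(negPart p r₁ * x + negPart p r₂ * y)) (i : Fin k) :
    insertion D (seriesAt i s) = -(negPartSeries r₁ i * seriesAt i.succ x +
      negPartSeries r₂ i * seriesAt i.succ y) := by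
  apply (MvPowerSeries.finSuccEquiv T k).injective
  rw [map_neg, map_add, map_mul, map_mul, finSuccEquiv_insertion, negPartSeries, negPartSeries,
    AlgEquiv.apply_symm_apply, AlgEquiv.apply_symm_apply, ← rename_succ_seriesAt,
    finSuccEquiv_rename_succ, ← rename_succ_seriesAt, finSuccEquiv_rename_succ]
  refine PowerSeries.ext fun p => ?_
  rw [map_neg, map_add, PowerSeries.coeff_mul_C, PowerSeries.coeff_mul_C]
  simp only [PowerSeries.coeff_mk]
  split_ifs
  · rw [coeffDeriv_rename, h, map_neg, map_add, map_mul, map_mul]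
  · simp

/-- The variation of `u_i ∧ v_j` when `∇u = -W u`, `∇v = -W v` with
`(w - z) W(z) = w (z R(w) - w R(z)) + w (w - z) R_0`, `R = -u ⊗ (v ∧ ·)`. -/
theorem wedge_variation {L : Type*} [CommRing L]
    {w zi zj a b c d ai bi ci di aj bj cj dj r11 r12 r21 r22 : L}
    {Wi11 Wi12 Wi21 Wi22 Wj11 Wj12 Wj21 Wj22 pi pj q : L}
    (hdet : a * d - c * b = -2) (hdeti : ai * di - ci * bi = -2) (htr : r11 + r22 = 2)
    (hi11 : (w - zi) * Wi11 = w * (zi * -(a * d) - w * -(ai * di)) + w * (w - zi) * r11)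
    (hi12 : (w - zi) * Wi12 = w * (zi * (a * b) - w * (ai * bi)) + w * (w - zi) * r12)
    (hi21 : (w - zi) * Wi21 = w * (zi * -(c * d) - w * -(ci * di)) + w * (w - zi) * r21)
    (hi22 : (w - zi) * Wi22 = w * (zi * (c * b) - w * (ci * bi)) + w * (w - zi) * r22)
    (hj11 : (w - zj) * Wj11 = w * (zj * -(a * d) - w * -(aj * dj)) + w * (w - zj) * r11)
    (hj12 : (w - zj) * Wj12 = w * (zj * (a * b) - w * (aj * bj)) + w * (w - zj) * r12)
    (hj21 : (w - zj) * Wj21 = w * (zj * -(c * d) - w * -(cj * dj)) + w * (w - zj) * r21)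
    (hj22 : (w - zj) * Wj22 = w * (zj * (c * b) - w * (cj * bj)) + w * (w - zj) * r22)
    (hpi : pi * (w - zi) = 1) (hpj : pj * (w - zj) = 1) (hq : q * (zj - zi) = 1) :
    (ai * -(Wj21 * bj + Wj22 * dj) + dj * -(Wi11 * ai + Wi12 * ci) -
        (ci * -(Wj11 * bj + Wj12 * dj) + bj * -(Wi21 * ai + Wi22 * ci))) * (zi * zj * q) =
      ((ai * d - ci * b) * (zi * w * pi)) * ((a * dj - c * bj) * (w * zj * -pj)) +
        (-(2 * w ^ 2 * pj) - -(2 * w ^ 2 * pi)) * ((ai * dj - ci * bj) * (zi * zj * q)) := by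
  generalize hS : ai * -(Wj21 * bj + Wj22 * dj) + dj * -(Wi11 * ai + Wi12 * ci) -
        (ci * -(Wj11 * bj + Wj12 * dj) + bj * -(Wi21 * ai + Wi22 * ci)) = S
  -- The identity with denominators cleared. `hdeti` gives `R(ξ_i) u_i = 2 u_i`, while `R(ξ_j) v_j =
  -- 0` holds identically. `hdet` gives `tr R(w) = 2`, so that `u_i ∧ R(w) v_j + R(w) u_i ∧ v_j = 2
  -- u_i ∧ v_j`, and `htr` plays the same role for the constant term `R_0`.
  have h : (w - zi) * (w - zj) * S =
      -((ai * d - ci * b) * (a * dj - c * bj)) * w ^ 2 * (zj - zi) +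
        2 * w ^ 2 * ((w - zj) - (w - zi)) * (ai * dj - ci * bj) := by
    rw [← hS]
    linear_combination (w - zi) * (-(ai * bj) * hj21 - ai * dj * hj22 + ci * bj * hj11 +
        ci * dj * hj12) + (w - zj) * (-(dj * ai) * hi11 - dj * ci * hi12 + bj * ai * hi21 +
        bj * ci * hi22) + w * zj * (w - zi) * (ai * dj - ci * bj) * hdet -
        w ^ 2 * (w - zj) * (ai * dj - ci * bj) * hdeti -
        w * (w - zi) * (w - zj) * (ai * dj - ci * bj) * htr
  have h' : S = -((ai * d - ci * b) * (a * dj - c * bj)) * w ^ 2 * (zj - zi) * (pi * pj) +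
      2 * w ^ 2 * (pi - pj) * (ai * dj - ci * bj) := by
    linear_combination pi * pj * h - S * (pj * (w - zj)) * hpi - S * hpj +
      2 * w ^ 2 * (ai * dj - ci * bj) * (pi * hpj - pj * hpi)
  rw [h']
  linear_combination -((ai * d - ci * b) * (a * dj - c * bj)) * w ^ 2 * (pi * pj) * zi * zj * hq

/-- `(a(ξ_i) d(ξ_j) - c(ξ_i) b(ξ_j)) / (ξ_i - ξ_j)`, to be used for `i ≠ j`. -/
def wedgeKernel (a b c d : PowerSeries T) (i j : Fin k) : DifferenceLocalization T k :=
  toLoc (seriesAt i a * seriesAt j d - seriesAt i c * seriesAt j b) *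
    (toLoc (MvPowerSeries.X i) * toLoc (MvPowerSeries.X j) *
      Ring.inverse (toLoc (MvPowerSeries.X j - MvPowerSeries.X i)))

theorem map_ringInverse_of_isUnit {A B : Type*} [CommRing A] [CommRing B] (f : A →+* B) {x : A}
    (hx : IsUnit x) : f (Ring.inverse x) = Ring.inverse (f x) := by
  have h : f (Ring.inverse x) * f x = 1 := by
    rw [← map_mul, Ring.inverse_mul_cancel _ hx, map_one]
  calc f (Ring.inverse x) = f (Ring.inverse x) * (f x * Ring.inverse (f x)) := by
        rw [Ring.mul_inverse_cancel _ (hx.map f), mul_one]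
    _ = Ring.inverse (f x) := by rw [← mul_assoc, h, one_mul]

theorem ringInverse_neg {A : Type*} [CommRing A] {x : A} (hx : IsUnit x) :
    Ring.inverse (-x) = -Ring.inverse x := by
  have h : -Ring.inverse x * -x = 1 := by rw [neg_mul_neg, Ring.inverse_mul_cancel _ hx]
  calc Ring.inverse (-x) = -Ring.inverse x * -x * Ring.inverse (-x) := by rw [h, one_mul]
    _ = -Ring.inverse x := by rw [mul_assoc, Ring.mul_inverse_cancel _ hx.neg, mul_one]

theorem shiftLoc_wedgeKernel (a b c d : PowerSeries T) {i j : Fin k} (hij : i ≠ j) :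
    shiftLoc (wedgeKernel a b c d i j) = wedgeKernel a b c d i.succ j.succ := by
  unfold wedgeKernel
  rw [map_mul, map_mul, map_mul, map_ringInverse_of_isUnit _ (isUnit_toLoc_X_sub_X hij.symm)]
  simp only [shiftLoc_toLoc, map_sub, map_mul, rename_succ_seriesAt, MvPowerSeries.rename_X]

section Variation

variable {δ : DifferenceLocalization T k →+ DifferenceLocalization T (k + 1)}

theorem derivation_ringInverse
    (hδ : ∀ x y, δ (x * y) = shiftLoc x * δ y + shiftLoc y * δ x)
    {x : DifferenceLocalization T k} (hx : IsUnit x) (h0 : δ x = 0) : δ (Ring.inverse x) = 0 := by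
  have h1 : δ 1 = 0 := by simpa using hδ 1 1
  have h := hδ (Ring.inverse x) x
  rw [Ring.inverse_mul_cancel _ hx, h1, h0, mul_zero, zero_add] at h
  exact ((hx.map shiftLoc).mul_right_eq_zero).1 h.symm

/-- The logarithmic variation of `v(ξ_j)` under insertion, up to terms common to all `j`. -/
def insertionWeight (j : Fin k) : DifferenceLocalization T (k + 1) :=
  -(2 * toLoc (MvPowerSeries.X 0) ^ 2 *
    Ring.inverse (toLoc (MvPowerSeries.X 0 - MvPowerSeries.X j.succ)))

/-- The prefactor of the kernel involves only the variables, so it is constant, and the variation is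
that of `u_i ∧ v_j`, computed in `wedge_variation`. The first term inserts the new point between `i`
and `j`; the second is a difference of weights, which cancels along cycles. -/
theorem derivation_wedgeKernel (D : ℕ → Derivation ℤ T T)
    (hD : ∀ s, δ (toLoc s) = toLoc (insertion D s))
    (hδ : ∀ x y, δ (x * y) = shiftLoc x * δ y + shiftLoc y * δ x)
    {a b c d : PowerSeries T} (hdet : a * d - c * b = -2)
    (ha : ∀ p, coeffDeriv Unit (D p) a =
      -(negPart p (-(a * d)) * a + negPart p (a * b) * c))
    (hc : ∀ p, coeffDeriv Unit (D p) c =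
      -(negPart p (-(c * d)) * a + negPart p (c * b) * c))
    (hb : ∀ p, coeffDeriv Unit (D p) b =
      -(negPart p (-(a * d)) * b + negPart p (a * b) * d))
    (hd : ∀ p, coeffDeriv Unit (D p) d =
      -(negPart p (-(c * d)) * b + negPart p (c * b) * d))
    {i j : Fin k} (hij : i ≠ j) :
    δ (wedgeKernel a b c d i j) =
      wedgeKernel a b c d i.succ 0 * wedgeKernel a b c d 0 j.succ +
        (insertionWeight j - insertionWeight i) *
          wedgeKernel a b c d i.succ j.succ := by
  have hX : ∀ l : Fin k, δ (toLoc (MvPowerSeries.X l)) = 0 := fun l => by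
    rw [hD, insertion_X, map_zero]
  have hq0 : δ (Ring.inverse (toLoc (MvPowerSeries.X j - MvPowerSeries.X i))) = 0 :=
    derivation_ringInverse hδ (isUnit_toLoc_X_sub_X hij.symm) (by
      rw [map_sub, map_sub, hX, hX, sub_zero])
  have hpref : δ (toLoc (MvPowerSeries.X i) * toLoc (MvPowerSeries.X j) *
      Ring.inverse (toLoc (MvPowerSeries.X j - MvPowerSeries.X i))) = 0 := by
    simp only [hδ, hX, hq0, mul_zero, add_zero]
  have hsij : i.succ ≠ j.succ := by simpa using hij
  have hpj : Ring.inverse (toLoc (MvPowerSeries.X j.succ - MvPowerSeries.X 0 :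
      MvPowerSeries (Fin (k + 1)) T)) =
      -Ring.inverse (toLoc (MvPowerSeries.X 0 - MvPowerSeries.X j.succ :
        MvPowerSeries (Fin (k + 1)) T)) := by
    rw [← ringInverse_neg (isUnit_toLoc_X_sub_X (Fin.succ_ne_zero j).symm), ← map_neg, neg_sub]
  have hW : ∀ (s : PowerSeries T) (l : Fin k), _ := fun s l =>
    congrArg toLoc (X_sub_X_mul_negPartSeries s l)
  have hdet' : ∀ l : Fin (k + 1), toLoc (seriesAt l a) * toLoc (seriesAt l d) -
      toLoc (seriesAt l c) * toLoc (seriesAt l b) = -2 := fun l => by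
    have := congrArg (fun s => toLoc (seriesAt l s)) hdet
    simpa only [map_mul, map_sub, map_neg, map_ofNat] using this
  have htr : toLoc (k := k + 1) (MvPowerSeries.C (PowerSeries.coeff 0 (-(a * d)))) +
      toLoc (MvPowerSeries.C (PowerSeries.coeff 0 (c * b))) = 2 := by
    rw [← map_add, ← map_add, ← map_add,
      show -(a * d) + c * b = PowerSeries.C 2 by rw [map_ofNat]; linear_combination -hdet,
      PowerSeries.coeff_zero_C, map_ofNat, map_ofNat]
  have key := wedge_variation (hdet' 0) (hdet' i.succ) htr
    (by simpa only [map_mul, map_add, map_sub, map_neg] using hW (-(a * d)) i)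
    (by simpa only [map_mul, map_add, map_sub, map_neg] using hW (a * b) i)
    (by simpa only [map_mul, map_add, map_sub, map_neg] using hW (-(c * d)) i)
    (by simpa only [map_mul, map_add, map_sub, map_neg] using hW (c * b) i)
    (by simpa only [map_mul, map_add, map_sub, map_neg] using hW (-(a * d)) j)
    (by simpa only [map_mul, map_add, map_sub, map_neg] using hW (a * b) j)
    (by simpa only [map_mul, map_add, map_sub, map_neg] using hW (-(c * d)) j)
    (by simpa only [map_mul, map_add, map_sub, map_neg] using hW (c * b) j)
    (by
      rw [← map_sub]
      exact Ring.inverse_mul_cancel _ (isUnit_toLoc_X_sub_X (Fin.succ_ne_zero i).symm))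
    (by
      rw [← map_sub]
      exact Ring.inverse_mul_cancel _ (isUnit_toLoc_X_sub_X (Fin.succ_ne_zero j).symm))
    (by
      rw [← map_sub]
      exact Ring.inverse_mul_cancel _ (isUnit_toLoc_X_sub_X hsij.symm))
  rw [wedgeKernel, hδ, hpref, mul_zero, zero_add, hD, map_mul (shiftLoc), map_mul (shiftLoc),
    map_ringInverse_of_isUnit _ (isUnit_toLoc_X_sub_X hij.symm), shiftLoc_toLoc, shiftLoc_toLoc,
    shiftLoc_toLoc, map_sub, MvPowerSeries.rename_X, MvPowerSeries.rename_X]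
  have hins : insertion D (seriesAt i a * seriesAt j d - seriesAt i c * seriesAt j b) =
      insertion D (seriesAt i a * seriesAt j d) - insertion D (seriesAt i c * seriesAt j b) := by
    rw [eq_sub_iff_add_eq, ← insertion_add, sub_add_cancel]
  rw [hins, insertion_mul, insertion_mul, insertion_seriesAt D ha, insertion_seriesAt D hb,
    insertion_seriesAt D hc, insertion_seriesAt D hd]
  simp only [rename_succ_seriesAt]
  unfold wedgeKernel insertionWeight
  rw [hpj]
  simp only [map_mul, map_add, map_sub, map_neg] at key ⊢
  rw [mul_comm]
  exact key

end Variation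

end Kernel

/-! ### Induction on the number of points. -/

section Induction

theorem derivation_along_prod {A B ι : Type*} [CommRing A] [CommRing B] [DecidableEq ι]
    (f : A →+* B) (δ : A →+ B) (hδ : ∀ x y, δ (x * y) = f x * δ y + f y * δ x)
    (s : Finset ι) (x : ι → A) :
    δ (∏ j ∈ s, x j) = ∑ j ∈ s, δ (x j) * ∏ l ∈ s.erase j, f (x l) := by
  have h1 : δ 1 = 0 := by simpa using hδ 1 1
  induction s using Finset.induction_on with
  | empty => simp [h1]
  | insert i s hi ih =>
    rw [Finset.prod_insert hi, hδ, ih, Finset.sum_insert hi, Finset.erase_insert hi, map_prod,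
      add_comm, mul_comm (∏ j ∈ s, f (x j)), Finset.mul_sum]
    congr 1
    refine Finset.sum_congr rfl fun j hj => ?_
    have hne : i ≠ j := fun h => hi (h ▸ hj)
    rw [Finset.erase_insert_of_ne hne, Finset.prod_insert fun h => hi (Finset.mem_of_mem_erase h)]
    ring

variable {T : Type u} [CommRing T]

theorem finRotate_ne {n : ℕ} (j : Fin (n + 2)) : finRotate (n + 2) j ≠ j := by
  simp

/-- By the Leibniz rule each factor in turn is replaced by its variation. The weights enter as `∑_j
(γ (σ j) - γ (σ (j + 1)))` times the whole product, and this sum vanishes by rotation. With at least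
two points no diagonal value of `E` occurs. -/
theorem derivation_permSum {n : ℕ}
    {δ : DifferenceLocalization T (n + 2) →+ DifferenceLocalization T (n + 3)}
    (hδ : ∀ x y, δ (x * y) = shiftLoc x * δ y + shiftLoc y * δ x)
    (E : Fin (n + 2) → Fin (n + 2) → DifferenceLocalization T (n + 2))
    (E' : Fin (n + 3) → Fin (n + 3) → DifferenceLocalization T (n + 3))
    (γ : Fin (n + 2) → DifferenceLocalization T (n + 3))
    (hE : ∀ i j, i ≠ j → shiftLoc (E i j) = E' i.succ j.succ)
    (hδE : ∀ i j, i ≠ j →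
      δ (E i j) = E' i.succ 0 * E' 0 j.succ + (γ j - γ i) * E' i.succ j.succ) :
    δ (permSum E) = ∑ σ : Equiv.Perm (Fin (n + 2)), ∑ j, insertedProd E' σ j := by
  classical
  rw [permSum, map_sum]
  refine Finset.sum_congr rfl fun σ _ => ?_
  have hne : ∀ j, σ (finRotate (n + 2) j) ≠ σ j := fun j h => finRotate_ne j (σ.injective h)
  rw [derivation_along_prod shiftLoc δ hδ]
  have hterm : ∀ j : Fin (n + 2), δ (E (σ (finRotate _ j)) (σ j)) *
      ∏ l ∈ Finset.univ.erase j, shiftLoc (E (σ (finRotate _ l)) (σ l)) =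
      insertedProd E' σ j + (γ (σ j) - γ (σ (finRotate _ j))) *
        ∏ l, E' (σ (finRotate _ l)).succ (σ l).succ := by
    intro j
    rw [hδE _ _ (hne j), Finset.prod_congr rfl fun l _ => hE _ _ (hne l),
      ← Finset.mul_prod_erase Finset.univ _ (Finset.mem_univ j), insertedProd]
    ring
  rw [Finset.sum_congr rfl fun j _ => hterm j, Finset.sum_add_distrib, ← Finset.sum_mul,
    Finset.sum_sub_distrib, Equiv.sum_comp (finRotate (n + 2)) fun j => γ (σ j), sub_self,
    zero_mul, add_zero]

theorem nsmul_left_cancel_of_isUnit {A : Type*} [CommRing A] {m : ℕ} (h : IsUnit (m : A))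
    {x y : A} (hxy : m • x = m • y) : x = y := by
  rw [nsmul_eq_mul, nsmul_eq_mul] at hxy
  exact h.mul_left_cancel hxy

/-- Closed formula for series generated from `G 2` by the insertion operator. -/
theorem toLoc_eq_neg_cyclicSum (hT : ∀ m : ℕ, m ≠ 0 → IsUnit (m : T))
    (D : ℕ → Derivation ℤ T T)
    {a b c d : PowerSeries T} (hdet : a * d - c * b = -2)
    (ha : ∀ p, coeffDeriv Unit (D p) a =
      -(negPart p (-(a * d)) * a + negPart p (a * b) * c))
    (hc : ∀ p, coeffDeriv Unit (D p) c =
      -(negPart p (-(c * d)) * a + negPart p (c * b) * c))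
    (hb : ∀ p, coeffDeriv Unit (D p) b =
      -(negPart p (-(a * d)) * b + negPart p (a * b) * d))
    (hd : ∀ p, coeffDeriv Unit (D p) d =
      -(negPart p (-(c * d)) * b + negPart p (c * b) * d))
    (G : ∀ k, MvPowerSeries (Fin k) T) (hG : ∀ k, insertion D (G k) = G (k + 1))
    (h2 : toLoc (G 2) = -cyclicSum (wedgeKernel a b c d) -
      4 * (toLoc (MvPowerSeries.X 0) * toLoc (MvPowerSeries.X 1) *
        Ring.inverse (toLoc (MvPowerSeries.X 1 - MvPowerSeries.X 0 :
          MvPowerSeries (Fin 2) T))) ^ 2) (n : ℕ) :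
    toLoc (G (n + 3)) = -cyclicSum (wedgeKernel (k := n + 3) a b c d) := by
  have hunit : ∀ (k m : ℕ), m ≠ 0 → IsUnit (m : DifferenceLocalization T k) := fun k m hm => by
    have := (hT m hm).map ((toLoc (T := T) (k := k)).comp MvPowerSeries.C)
    rwa [map_natCast] at this
  -- The term `x` stands for any correction annihilated by insertion: the double pole when passing
  -- from two points to three, and `0` afterwards.
  have step : ∀ (n : ℕ) (x : DifferenceLocalization T (n + 2)),
      (∀ δ : DifferenceLocalization T (n + 2) →+ DifferenceLocalization T (n + 3),
        (∀ s, δ (toLoc s) = toLoc (insertion D s)) →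
        (∀ x y, δ (x * y) = shiftLoc x * δ y + shiftLoc y * δ x) → δ x = 0) →
      toLoc (G (n + 2)) = -cyclicSum (wedgeKernel a b c d) - x →
      toLoc (G (n + 3)) = -cyclicSum (wedgeKernel a b c d) := by
    intro n x hx h
    obtain ⟨δ, hδ1, hδ2⟩ := exists_insertLoc (k := n + 2) D
    have hperm := derivation_permSum hδ2 (wedgeKernel a b c d) (wedgeKernel a b c d)
      insertionWeight (fun i j hij => shiftLoc_wedgeKernel a b c d hij)
      (fun i j hij => derivation_wedgeKernel D hδ1 hδ2 hdet ha hc hb hd hij)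
    rw [sum_insertedProd (n := n + 1), ← nsmul_cyclicSum (by omega), map_nsmul] at hperm
    have hcyc := nsmul_left_cancel_of_isUnit (hunit (n + 3) (n + 2) (by omega)) hperm
    have hnext := nsmul_cyclicSum (k := n + 3) (by omega)
      (wedgeKernel (k := n + 3) a b c d)
    -- Both the variation of the old cyclic sum and the new cyclic sum equal the sum of insertions
    -- at the last position, once the factors `n + 2` and `n + 3` are cancelled.
    rw [permSum_succ (n := n + 1), ← hcyc] at hnext
    have hnext' := nsmul_left_cancel_of_isUnit (hunit (n + 3) (n + 3) (by omega)) hnext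
    have := congrArg δ h
    rw [hδ1, hG, map_sub, map_neg, hx δ hδ1 hδ2, sub_zero] at this
    rw [this, hnext']
  induction n with
  | zero =>
    refine step 0 _ (fun δ hδ1 hδ2 => ?_) h2
    have hX : ∀ l : Fin 2, δ (toLoc (MvPowerSeries.X l)) = 0 := fun l => by
      rw [hδ1, insertion_X, map_zero]
    have hq : δ (Ring.inverse (toLoc (MvPowerSeries.X 1 - MvPowerSeries.X 0))) = 0 :=
      derivation_ringInverse hδ2 (isUnit_toLoc_X_sub_X (by decide)) (by
        rw [map_sub, map_sub, hX, hX, sub_zero])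
    have h1 : δ 1 = 0 := by simpa using hδ2 1 1
    have h4 : δ 4 = 0 := by
      rw [show (4 : DifferenceLocalization T 2) = 1 + 1 + (1 + 1) by norm_num, map_add, map_add,
        h1, add_zero, add_zero]
    simp only [sq, hδ2, hX, hq, h4, mul_zero, add_zero]
  | succ n ih =>
    exact step (n + 1) 0 (fun δ _ _ => map_zero δ) (by rw [sub_zero]; exact ih)

end Induction

/-- Derivations of a ring with values in itself, linear over `ℤ`. -/
abbrev SelfDerivation (T : Type u) [CommRing T] : Type u := Derivation ℤ T T

/-- An additive map satisfying the Leibniz rule as a derivation. -/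
def derivationOfLeibniz {T : Type u} [CommRing T] (δ : T →+ T)
    (h : ∀ f g, δ (f * g) = f * δ g + g * δ f) : SelfDerivation T :=
  Derivation.mk' δ.toIntLinearMap h

theorem derivationOfLeibniz_apply {T : Type u} [CommRing T] (δ : T →+ T)
    (h : ∀ f g, δ (f * g) = f * δ g + g * δ f) (f : T) : derivationOfLeibniz δ h f = δ f := rfl

theorem selfDerivation_pow_eq_zero {T : Type u} [CommRing T] (δ : SelfDerivation T) {f : T}
    (h : δ f = 0) (k : ℕ) : δ (f ^ k) = 0 := by
  rw [Derivation.leibniz_pow, h, smul_zero, smul_zero]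

/-! ### Time derivations and insertion into correlation functions. -/

section TimeDerivations

variable {𝓕 : Type u} [CommRing 𝓕] [Algebra ℂ 𝓕] (dX : Derivation ℂ 𝓕 𝓕)

theorem dXLaurent_mul (f g : LaurentSeries 𝓕) :
    dXLaurent dX (f * g) = f * dXLaurent dX g + g * dXLaurent dX f := by
  -- Differentiation of coefficients does not enlarge supports, so all three convolutions can be
  -- taken over the same finite index set.
  have hsupp : ∀ f : LaurentSeries 𝓕, (dXLaurent dX f).support ⊆ f.support := by
    intro f n hn h0
    apply hn
    change dX (f.coeff n) = 0
    rw [h0, map_zero]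
  ext n
  rw [mul_comm g, HahnSeries.coeff_add,
    HahnSeries.coeff_mul_right' g.isPWO_support (hsupp g),
    HahnSeries.coeff_mul_left' f.isPWO_support (hsupp f)]
  change dX ((f * g).coeff n) = _
  rw [HahnSeries.coeff_mul, map_sum, ← Finset.sum_add_distrib]
  refine Finset.sum_congr rfl fun p _ => ?_
  rw [Derivation.leibniz, smul_eq_mul, smul_eq_mul, mul_comm (g.coeff p.2)]
  rfl

theorem timeDeriv_mul (j : ℕ) (f g : TimeSeries 𝓕) :
    timeDeriv dX j (f * g) = f * timeDeriv dX j g + g * timeDeriv dX j f := by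
  cases j with
  | zero =>
    exact coeffDeriv_mul (derivationOfLeibniz (dXLaurent dX) (dXLaurent_mul dX)) f g
  | succ j => exact (MvPowerSeries.pderiv (LaurentSeries 𝓕) j).leibniz f g

theorem timeDeriv_C_single (j : ℕ) (m : ℤ) {x : 𝓕} (hx : dX x = 0) :
    timeDeriv dX j (MvPowerSeries.C (HahnSeries.single m x) : TimeSeries 𝓕) = 0 := by
  cases j with
  | zero =>
    have h := coeffDeriv_C (σ := ℕ) (derivationOfLeibniz (dXLaurent dX) (dXLaurent_mul dX))
      (HahnSeries.single m x)
    have h0 : dXLaurent dX (HahnSeries.single m x) = 0 := by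
      refine HahnSeries.ext (funext fun n => ?_)
      change dX ((HahnSeries.single m x).coeff n) = 0
      rw [HahnSeries.coeff_single]
      split_ifs
      · exact hx
      · exact map_zero dX
    rw [derivationOfLeibniz_apply, h0, map_zero] at h
    exact h
  | succ j => exact MvPowerSeries.pderiv_C

theorem timeDeriv_eps (j : ℕ) : timeDeriv dX j (eps : TimeSeries 𝓕) = 0 :=
  timeDeriv_C_single dX j _ (by simp)

theorem algebraMap_timeSeries (c : ℂ) : algebraMap ℂ (TimeSeries 𝓕) c =
    MvPowerSeries.C (HahnSeries.single 0 (algebraMap ℂ 𝓕 c)) := by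
  rw [MvPowerSeries.algebraMap_apply, HahnSeries.algebraMap_apply',
    PowerSeries.algebraMap_apply]
  congr 1
  exact HahnSeries.ofPowerSeries_C _

theorem timeDeriv_smul (j : ℕ) (c : ℂ) (f : TimeSeries 𝓕) :
    timeDeriv dX j (c • f) = c • timeDeriv dX j f := by
  rw [Algebra.smul_def, timeDeriv_mul, algebraMap_timeSeries, timeDeriv_C_single dX j _ (by simp),
    mul_zero, add_zero, ← algebraMap_timeSeries, ← Algebra.smul_def]

/-- `∂/∂t_j` as a derivation. -/
def timeDerivation (j : ℕ) : SelfDerivation (TimeSeries 𝓕) :=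
  derivationOfLeibniz (timeDeriv dX j) (timeDeriv_mul dX j)

theorem timeDerivation_apply (j : ℕ) (f : TimeSeries 𝓕) :
    timeDerivation dX j f = timeDeriv dX j f := rfl

/-- The derivations `2^{-j} ε ∂/∂t_j`. -/
def scaledDerivation (j : ℕ) : SelfDerivation (TimeSeries 𝓕) :=
  derivationOfLeibniz
    ((AddMonoidHom.mulLeft (algebraMap ℂ (TimeSeries 𝓕) ((1 / 2) ^ j) * eps)).comp
      (timeDeriv dX j)) fun f g => by
    simp only [AddMonoidHom.comp_apply, AddMonoidHom.coe_mulLeft, timeDeriv_mul]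
    ring

theorem scaledDerivation_apply (j : ℕ) (f : TimeSeries 𝓕) :
    scaledDerivation dX j f = ((1 / 2 : ℂ) ^ j) • (eps * timeDeriv dX j f) := by
  change (algebraMap ℂ (TimeSeries 𝓕) ((1 / 2) ^ j) * eps) * timeDeriv dX j f = _
  rw [Algebra.smul_def, mul_assoc]

theorem isUnit_natCast_timeSeries (m : ℕ) (hm : m ≠ 0) : IsUnit (m : TimeSeries 𝓕) := by
  have h : IsUnit (m : ℂ) := isUnit_iff_ne_zero.2 (Nat.cast_ne_zero.2 hm)
  have := h.map (algebraMap ℂ (TimeSeries 𝓕))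
  rwa [map_natCast] at this

theorem correlation_cons (logτ : TimeSeries 𝓕) {k : ℕ} (i : Fin (k + 1) → ℕ) :
    correlation dX logτ i =
      eps * timeDeriv dX (i 0) (correlation dX logτ fun j => i j.succ) := by
  unfold correlation
  have h : ∀ x : TimeSeries 𝓕, timeDeriv dX (i 0) (eps ^ k * x) =
      eps ^ k * timeDeriv dX (i 0) x := by
    intro x
    have hpow : timeDeriv dX (i 0) (eps ^ k : TimeSeries 𝓕) = 0 :=
      selfDerivation_pow_eq_zero (timeDerivation dX (i 0)) (timeDeriv_eps dX (i 0)) k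
    rw [timeDeriv_mul, hpow, mul_zero, add_zero]
  rw [h, List.ofFn_succ, List.foldr_cons, pow_succ, mul_comm (eps ^ k), mul_assoc]

theorem coeff_correlationSeries_of_le (logτ : TimeSeries 𝓕) {k : ℕ} {n : Fin k →₀ ℕ}
    (h : ∀ j, 2 ≤ n j) : MvPowerSeries.coeff n (correlationSeries dX logτ k) =
      (∏ j, (1 / 2 : ℂ) ^ (n j - 2)) • correlation dX logτ (fun j => n j - 2) :=
  if_pos h

theorem coeff_correlationSeries_of_not_le (logτ : TimeSeries 𝓕) {k : ℕ} {n : Fin k →₀ ℕ}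
    (h : ¬∀ j, 2 ≤ n j) : MvPowerSeries.coeff n (correlationSeries dX logτ k) = 0 :=
  if_neg h

/-- The coefficient of `w^{p+2}` applies `2^{-p} ε ∂_p`, which by `correlation_cons` prepends the
index `p` and contributes its power of `1/2`. -/
theorem insertion_correlationSeries (logτ : TimeSeries 𝓕) (k : ℕ) :
    insertion (scaledDerivation dX) (correlationSeries dX logτ k) =
      correlationSeries dX logτ (k + 1) := by
  refine MvPowerSeries.ext fun n => ?_
  rw [coeff_insertion]
  by_cases h0 : 2 ≤ n 0
  · by_cases h1 : ∀ j : Fin k, 2 ≤ n.tail j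
    · rw [if_pos h0, coeff_correlationSeries_of_le dX logτ h1,
        coeff_correlationSeries_of_le dX logτ (Fin.forall_fin_succ.2 ⟨h0, h1⟩),
        scaledDerivation_apply, timeDeriv_smul, correlation_cons, Fin.prod_univ_succ]
      simp only [Finsupp.tail_apply, Algebra.smul_def, map_mul]
      ring
    · rw [if_pos h0, coeff_correlationSeries_of_not_le dX logτ h1,
        coeff_correlationSeries_of_not_le dX logτ fun h => h1 (Fin.forall_fin_succ.1 h).2, map_zero]
  · rw [if_neg h0,
      coeff_correlationSeries_of_not_le dX logτ fun h => h0 (Fin.forall_fin_succ.1 h).1]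

end TimeDerivations

/-! ### Laurent series in the inverse spectral parameter and the reduced wave equations. -/

section Spectral

variable {𝓕 : Type u} [CommRing 𝓕]

/-- Power series in `ξ⁻¹` as Laurent series. -/
abbrev ofPower : PowerSeries (TimeSeries 𝓕) →+* SpectralSeries 𝓕 :=
  HahnSeries.ofPowerSeries ℤ (TimeSeries 𝓕)

theorem coeff_ofPower (s : PowerSeries (TimeSeries 𝓕)) (m : ℤ) :
    (ofPower s).coeff m = if m < 0 then 0 else PowerSeries.coeff m.natAbs s :=
  PowerSeries.coeff_coe s m

theorem ofPower_injective : Function.Injective (ofPower (𝓕 := 𝓕)) :=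
  HahnSeries.ofPowerSeries_injective

theorem xi_mul_ofPower_X : (xi : SpectralSeries 𝓕) * ofPower PowerSeries.X = 1 := by
  rw [xi, HahnSeries.ofPowerSeries_X, HahnSeries.single_mul_single]
  simp

theorem eps_mul_epsInv : (eps : TimeSeries 𝓕) * epsInv = 1 := by
  rw [eps, epsInv, ← map_mul, HahnSeries.single_mul_single]
  simp

theorem hahnSeries_C_eq (t : TimeSeries 𝓕) :
    (HahnSeries.C t : SpectralSeries 𝓕) = ofPower (PowerSeries.C t) :=
  (HahnSeries.ofPowerSeries_C t).symm

theorem coeff_xi_pow_mul (k : ℕ) (f : SpectralSeries 𝓕) (m : ℤ) :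
    ((xi : SpectralSeries 𝓕) ^ k * f).coeff m = f.coeff (m + k) := by
  rw [xi, HahnSeries.single_pow, HahnSeries.coeff_single_mul]
  simp

theorem polyPart_xi_pow_mul (k : ℕ) (s : PowerSeries (TimeSeries 𝓕)) :
    polyPart ((xi : SpectralSeries 𝓕) ^ (k + 1) * ofPower s) =
      xi ^ (k + 1) * ofPower s - ofPower (negPart k s) := by
  refine HahnSeries.ext (funext fun m => ?_)
  rw [polyPart, HahnSeries.coeff_truncLT, HahnSeries.coeff_sub, coeff_xi_pow_mul, coeff_ofPower,
    coeff_ofPower]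
  by_cases hm : m < 1
  · rw [if_pos hm]
    by_cases hm0 : m < 0
    · rw [if_pos hm0, sub_zero]
    · have : m = 0 := by omega
      subst this
      simp [negPart]
  · rw [if_neg hm, if_neg (by omega), if_neg (by omega), negPart, PowerSeries.coeff_mk,
      if_neg (by omega), show (m + (k + 1 : ℕ)).natAbs = k + 1 + m.natAbs by omega, sub_self]

variable [Algebra ℂ 𝓕] (dX : Derivation ℂ 𝓕 𝓕)

/-- `∂/∂t_j` acting coefficientwise on power series in `ξ⁻¹`. -/
abbrev powerDeriv (j : ℕ) := coeffDeriv Unit (timeDerivation dX j)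

theorem spectralDeriv_ofPower (j : ℕ) (s : PowerSeries (TimeSeries 𝓕)) :
    spectralDeriv dX j (ofPower s) = ofPower (powerDeriv dX j s) := by
  refine HahnSeries.ext (funext fun m => ?_)
  change timeDeriv dX j ((ofPower s).coeff m) = _
  rw [coeff_ofPower, coeff_ofPower]
  split_ifs
  · exact map_zero _
  · rfl

theorem spectralDeriv_xi_mul (j : ℕ) (f : SpectralSeries 𝓕) :
    spectralDeriv dX j (xi * f) = xi * spectralDeriv dX j f := by
  refine HahnSeries.ext (funext fun m => ?_)
  change timeDeriv dX j ((xi * f).coeff m) = _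
  have h := coeff_xi_pow_mul (𝓕 := 𝓕) 1
  simp only [pow_one] at h
  rw [h, h]
  rfl

theorem powerDeriv_mul (j : ℕ) (s t : PowerSeries (TimeSeries 𝓕)) :
    powerDeriv dX j (s * t) = s * powerDeriv dX j t + t * powerDeriv dX j s :=
  coeffDeriv_mul _ _ _

theorem powerDeriv_X_mul (j : ℕ) (s : PowerSeries (TimeSeries 𝓕)) :
    powerDeriv dX j (PowerSeries.X * s) = PowerSeries.X * powerDeriv dX j s := by
  rw [powerDeriv_mul]
  have : powerDeriv dX j (PowerSeries.X : PowerSeries (TimeSeries 𝓕)) = 0 := coeffDeriv_X _ _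
  rw [this, mul_zero, add_zero]

theorem coeffDeriv_scaledDerivation (j : ℕ) (s : PowerSeries (TimeSeries 𝓕)) :
    2 ^ j * coeffDeriv Unit (scaledDerivation dX j) s = PowerSeries.C eps * powerDeriv dX j s := by
  have h2 : (2 : PowerSeries (TimeSeries 𝓕)) ^ j = PowerSeries.C (2 ^ j) := by
    rw [map_pow, map_ofNat]
  rw [h2]
  ext1 n
  rw [PowerSeries.coeff_C_mul, PowerSeries.coeff_C_mul, powerSeries_coeff_coeffDeriv,
    powerSeries_coeff_coeffDeriv, scaledDerivation_apply, timeDerivation_apply, Algebra.smul_def,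
    ← mul_assoc]
  have : (2 : TimeSeries 𝓕) ^ j * algebraMap ℂ (TimeSeries 𝓕) ((1 / 2) ^ j) = 1 := by
    rw [← map_ofNat (algebraMap ℂ (TimeSeries 𝓕)) 2, ← map_pow, ← map_mul, ← mul_pow]
    norm_num
  rw [this, one_mul]

/-! ### Elements with a single exponential -/

omit [Algebra ℂ 𝓕] in
theorem ofSpectral_mul_single (f g : SpectralSeries 𝓕) (n : ℤ) :
    ofSpectral f * (AddMonoidAlgebra.single n g : WaveRing 𝓕) =
      AddMonoidAlgebra.single n (f * g) := by
  rw [ofSpectral]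
  change AddMonoidAlgebra.single 0 f * _ = _
  rw [AddMonoidAlgebra.single_mul_single, zero_add]

theorem waveDeriv_single (j : ℕ) (n : ℤ) (f : SpectralSeries 𝓕) :
    waveDeriv dX j (AddMonoidAlgebra.single n f) = AddMonoidAlgebra.single n
      (spectralDeriv dX j f +
        (n : SpectralSeries 𝓕) * (HahnSeries.C epsInv * 2 ^ j * xi ^ (j + 1)) * f) := by
  have h0 : spectralDeriv dX j (0 : SpectralSeries 𝓕) = 0 := by
    have := spectralDeriv_ofPower dX j 0
    simpa using this
  rw [waveDeriv, AddMonoidAlgebra.coeff_single, Finsupp.sum_single_index]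
  rw [h0, mul_zero, add_zero, AddMonoidAlgebra.single_zero]

/-- The factor `n - 1` collects `nξ` from differentiating `e^{nθ}` and `-ξ` from the definition of
the vector. It vanishes for type A and equals `-2` for type B, which is why the second component is
a power series in the first case and `ξ` times one in the second. -/
theorem waveVector_single (q : TimeSeries 𝓕) (n : ℤ) (f : SpectralSeries 𝓕) (b : Fin 2) :
    waveVector dX q (AddMonoidAlgebra.single n f) b = AddMonoidAlgebra.single n
      (![f, HahnSeries.C (Ring.inverse q) * (HahnSeries.C eps * spectralDeriv dX 0 f +
        ((n : SpectralSeries 𝓕) - 1) * xi * f)] b) := by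
  have he : (HahnSeries.C eps : SpectralSeries 𝓕) * HahnSeries.C epsInv = 1 := by
    rw [← map_mul, eps_mul_epsInv, map_one]
  fin_cases b
  · rfl
  · change ofSpectral _ * (ofSpectral _ * waveDeriv dX 0 _ - ofSpectral _ * _) = _
    rw [waveDeriv_single, ofSpectral_mul_single, ofSpectral_mul_single,
      ← AddMonoidAlgebra.single_sub, ofSpectral_mul_single]
    congr 1
    simp only [Matrix.cons_val_one, Matrix.cons_val_fin_one, Fin.mk_one, Fin.isValue]
    linear_combination HahnSeries.C (Ring.inverse q) * n * xi * f * he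

/-- The wave equations for `(f, g) e^{nθ}` with `(f, g)` the vector of `f`. -/
theorem SatisfiesWaveEquations.single {q r : TimeSeries 𝓕} {n : ℤ} {f : SpectralSeries 𝓕}
    (h : SatisfiesWaveEquations dX q r (AddMonoidAlgebra.single n f)) {v : Fin 2 → SpectralSeries 𝓕}
    (hv : v = ![f, HahnSeries.C (Ring.inverse q) * (HahnSeries.C eps * spectralDeriv dX 0 f +
        ((n : SpectralSeries 𝓕) - 1) * xi * f)]) (k : ℕ) (b : Fin 2) :
    HahnSeries.C eps * spectralDeriv dX k (v b) + (n : SpectralSeries 𝓕) * 2 ^ k * xi ^ (k + 1) * v b =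
      2 ^ k * (laxV dX q r k b 0 * v 0 + laxV dX q r k b 1 * v 1 - xi ^ (k + 1) * v b) := by
  have he : (HahnSeries.C eps : SpectralSeries 𝓕) * HahnSeries.C epsInv = 1 := by
    rw [← map_mul, eps_mul_epsInv, map_one]
  have hw : waveVector dX q (AddMonoidAlgebra.single n f) =
      fun b => AddMonoidAlgebra.single n (v b) := by
    funext b
    rw [waveVector_single, hv]
  have h1 := h k b
  rw [hw] at h1
  simp only [Matrix.mulVec, dotProduct, Fin.sum_univ_two, Matrix.map_apply] at h1
  rw [waveDeriv_single, ofSpectral_mul_single, ofSpectral_mul_single,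
    ← AddMonoidAlgebra.single_add] at h1
  have h2 : (ofTime epsInv * 2 ^ k : WaveRing 𝓕) =
      ofSpectral (HahnSeries.C epsInv * 2 ^ k) := by
    rw [map_mul, map_pow, map_ofNat]
    rfl
  rw [h2, ofSpectral_mul_single] at h1
  replace h1 := AddMonoidAlgebra.single_right_inj.1 h1
  have h3 : ∀ c, (laxV dX q r k - (xi : SpectralSeries 𝓕) ^ (k + 1) •
      (1 : Matrix (Fin 2) (Fin 2) (SpectralSeries 𝓕))) b c =
      laxV dX q r k b c - xi ^ (k + 1) * (1 : Matrix (Fin 2) (Fin 2) (SpectralSeries 𝓕)) b c :=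
    fun c => rfl
  rw [h3, h3] at h1
  have h4 : ∀ b, (1 : Matrix (Fin 2) (Fin 2) (SpectralSeries 𝓕)) b 0 * v 0 +
      (1 : Matrix (Fin 2) (Fin 2) (SpectralSeries 𝓕)) b 1 * v 1 = v b := by
    rw [Fin.forall_fin_two, Matrix.one_apply_eq, Matrix.one_apply_eq,
      Matrix.one_apply_ne (by decide), Matrix.one_apply_ne (by decide)]
    simp
  linear_combination HahnSeries.C eps * h1 - (n * 2 ^ k * xi ^ (k + 1) * v b) * he +
    (2 ^ k * (laxV dX q r k b 0 * v 0 + laxV dX q r k b 1 * v 1 - xi ^ (k + 1) * v b)) * he -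
    HahnSeries.C eps * HahnSeries.C epsInv * 2 ^ k * xi ^ (k + 1) * h4 b

end Spectral

/-! ### The resolvent as a rank-one matrix. -/

section Resolvent

variable {𝓕 : Type u} [CommRing 𝓕] [Algebra ℂ 𝓕] (dX : Derivation ℂ 𝓕 𝓕)

theorem algebraMap_half_mul_two :
    algebraMap ℂ (TimeSeries 𝓕) (1 / 2) * 2 = 1 := by
  rw [← map_ofNat (algebraMap ℂ (TimeSeries 𝓕)) 2, ← map_mul]
  norm_num

theorem powerSeries_two_mul_cancel {f g : PowerSeries (TimeSeries 𝓕)} (h : 2 * f = 2 * g) :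
    f = g := by
  have h2 : PowerSeries.C (algebraMap ℂ (TimeSeries 𝓕) (1 / 2)) * 2 = 1 := by
    rw [← map_ofNat PowerSeries.C 2, ← map_mul, algebraMap_half_mul_two, map_one]
  linear_combination PowerSeries.C (algebraMap ℂ (TimeSeries 𝓕) (1 / 2)) * h - (f - g) * h2

/-- The coefficients of `-u ⊗ (v ∧ ·)` with `u = (a, c)`, `v = (z b, d)`, satisfy the recursion
which defines the basic matrix resolvent. -/
theorem resolventABC_eq {q r : TimeSeries 𝓕} {a b c d : PowerSeries (TimeSeries 𝓕)}
    (hdet : a * d - c * (PowerSeries.X * b) = -2)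
    (ha : PowerSeries.C eps * powerDeriv dX 0 a = PowerSeries.C q * c)
    (hb : PowerSeries.X * (PowerSeries.C eps * powerDeriv dX 0 b) = PowerSeries.C q * d + 2 * b)
    (hc : PowerSeries.X * (PowerSeries.C eps * powerDeriv dX 0 c) =
      -(PowerSeries.C r * (PowerSeries.X * a)) - 2 * c)
    (hd : PowerSeries.C eps * powerDeriv dX 0 d = -(PowerSeries.C r * (PowerSeries.X * b)))
    (n : ℕ) :
    resolventABC dX q r n = (PowerSeries.coeff n (-(c * b)), PowerSeries.coeff n (a * b),
      PowerSeries.coeff (n + 1) (-(c * d))) := by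
  let hf : PowerSeries (TimeSeries 𝓕) := PowerSeries.C (algebraMap ℂ (TimeSeries 𝓕) (1 / 2))
  -- `hB` and `hC` are the generating-series forms of the recursions for `B_n` and `C_n`. They
  -- follow from the product rule for `a b` and `c d` together with the determinant relation.
  have hB : a * b = PowerSeries.C q + PowerSeries.C q * (PowerSeries.X * -(c * b)) +
      PowerSeries.X * (hf * (PowerSeries.C eps * powerDeriv dX 0 (a * b))) := by
    apply powerSeries_two_mul_cancel
    have h2 : hf * 2 = 1 := by
      rw [← map_ofNat PowerSeries.C 2, ← map_mul, algebraMap_half_mul_two, map_one]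
    rw [powerDeriv_mul]
    linear_combination -(a * hb) - PowerSeries.X * b * ha - PowerSeries.C q * hdet -
      PowerSeries.X * PowerSeries.C eps * (a * powerDeriv dX 0 b + b * powerDeriv dX 0 a) * h2
  have hC : -(c * d) = -(PowerSeries.X * PowerSeries.C r) -
      PowerSeries.X * (PowerSeries.X * (PowerSeries.C r * -(c * b))) -
      PowerSeries.X * (hf * (PowerSeries.C eps * powerDeriv dX 0 (-(c * d)))) := by
    apply powerSeries_two_mul_cancel
    have h2 : hf * 2 = 1 := by
      rw [← map_ofNat PowerSeries.C 2, ← map_mul, algebraMap_half_mul_two, map_one]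
    rw [map_neg, powerDeriv_mul]
    linear_combination -(d * hc) - PowerSeries.X * c * hd + PowerSeries.C r * PowerSeries.X * hdet -
      PowerSeries.X * PowerSeries.C eps * (c * powerDeriv dX 0 d + d * powerDeriv dX 0 c) * h2
  have hγ0 : PowerSeries.X ∣ -(c * d) := by
    rw [hC]
    refine Dvd.dvd.sub (Dvd.dvd.sub (Dvd.dvd.neg_right ?_) ?_) ?_ <;> exact Dvd.intro _ rfl
  obtain ⟨γ, hγ⟩ := hγ0
  -- This is `det R = 0` with `R_11 = 2 + A`, that is `2A = -(A² + BC)`, after removing the common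
  -- power of `ξ⁻¹`.
  have hA : -(c * b) = -(hf * (PowerSeries.X * (-(c * b) * -(c * b) + a * b * γ))) := by
    apply powerSeries_two_mul_cancel
    have h2 : hf * 2 = 1 := by
      rw [← map_ofNat PowerSeries.C 2, ← map_mul, algebraMap_half_mul_two, map_one]
    linear_combination -(a * b) * hγ - c * b * hdet +
      (PowerSeries.X * (-(c * b) * -(c * b) + a * b * γ)) * h2
  have hγn : ∀ n, PowerSeries.coeff (n + 1) (-(c * d)) = PowerSeries.coeff n γ := fun n => by
    rw [hγ, PowerSeries.coeff_succ_X_mul]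
  rw [hγn]
  have hpd : ∀ (s : PowerSeries (TimeSeries 𝓕)) n, PowerSeries.coeff n (powerDeriv dX 0 s) =
    timeDeriv dX 0 (PowerSeries.coeff n s) := fun s n => rfl
  have hC' : γ = -(PowerSeries.C r) - PowerSeries.X * (PowerSeries.C r * -(c * b)) -
      PowerSeries.X * (hf * (PowerSeries.C eps * powerDeriv dX 0 γ)) := by
    rw [hγ, powerDeriv_X_mul] at hC
    apply PowerSeries.X_mul_cancel
    linear_combination hC
  induction n using Nat.strong_induction_on with
  | _ n ih =>
    cases n with
    | zero =>
      rw [resolventABC]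
      congr 1
      · rw [hA]
        simp
      · congr 1
        · rw [hB]
          simp
        · rw [hC']
          simp
    | succ n =>
      rw [resolventABC]
      have ihn := ih n (Nat.lt_succ_self n)
      congr 1
      · rw [hA, map_neg, PowerSeries.coeff_C_mul, PowerSeries.coeff_succ_X_mul, map_add,
          PowerSeries.coeff_mul, PowerSeries.coeff_mul, ← Finset.sum_add_distrib,
          Finset.Nat.sum_antidiagonal_eq_sum_range_succ_mk, Finset.sum_range, Algebra.smul_def]
        congr 2
        refine Finset.sum_congr rfl fun i _ => ?_
        rw [ih i (by omega), ih (n - i) (by omega)]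
      · rw [ihn]
        congr 1
        · conv_rhs => rw [hB]
          rw [map_add, map_add, PowerSeries.coeff_C_mul, PowerSeries.coeff_succ_X_mul,
            PowerSeries.coeff_succ_X_mul, PowerSeries.coeff_C_mul, PowerSeries.coeff_C_mul, hpd,
            PowerSeries.coeff_C, if_neg (Nat.succ_ne_zero n), Algebra.smul_def]
          ring
        · conv_rhs => rw [hC']
          rw [map_sub, map_sub, map_neg _ (PowerSeries.C r), PowerSeries.coeff_succ_X_mul,
            PowerSeries.coeff_succ_X_mul, PowerSeries.coeff_C_mul, PowerSeries.coeff_C_mul,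
            PowerSeries.coeff_C_mul, hpd,
            PowerSeries.coeff_C, if_neg (Nat.succ_ne_zero n), Algebra.smul_def]
          ring

/-- `-u ⊗ (v ∧ ·)` with `u = (a, c)`, `v = (b, d)`. -/
def rankOneResolvent {T : Type*} [CommRing T] (a b c d : PowerSeries T) :
    Matrix (Fin 2) (Fin 2) (PowerSeries T) :=
  !![-(a * d), a * b; -(c * d), c * b]

/-- The index shifts match as follows: the determinant relation gives `-(a d) = 2 + X(-(c b))`, the
factor `X` of `X * b` shifts the second column, and `-(c d)` starts at order one by `hγ`. -/
theorem basicResolvent_eq {q r : TimeSeries 𝓕} {a b c d : PowerSeries (TimeSeries 𝓕)}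
    (hdet : a * d - c * (PowerSeries.X * b) = -2)
    (hγ : PowerSeries.X ∣ c * d)
    (h : ∀ n, resolventABC dX q r n = (PowerSeries.coeff n (-(c * b)), PowerSeries.coeff n (a * b),
      PowerSeries.coeff (n + 1) (-(c * d)))) :
    basicResolvent dX q r = (rankOneResolvent a (PowerSeries.X * b) c d).map ofPower := by
  have key : ∀ i j : Fin 2, (PowerSeries.mk fun n => resolventCoeff dX q r n i j) =
      rankOneResolvent a (PowerSeries.X * b) c d i j := by
    intro i j
    ext1 n
    rw [PowerSeries.coeff_mk]
    have h00 : -(a * d) = PowerSeries.C 2 + PowerSeries.X * -(c * b) := by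
      rw [map_ofNat]
      linear_combination -hdet
    cases n with
    | zero =>
      obtain ⟨γ, hγ⟩ := hγ
      fin_cases i <;> fin_cases j
      · change 2 = PowerSeries.coeff 0 (-(a * d))
        rw [h00]
        simp
      · change 0 = PowerSeries.coeff 0 (a * (PowerSeries.X * b))
        simp
      · change 0 = PowerSeries.coeff 0 (-(c * d))
        rw [hγ]
        simp
      · change 0 = PowerSeries.coeff 0 (c * (PowerSeries.X * b))
        simp
    | succ n =>
      rw [resolventCoeff, h n]
      fin_cases i <;> fin_cases j
      · change PowerSeries.coeff n (-(c * b)) = PowerSeries.coeff (n + 1) (-(a * d))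
        rw [h00, map_add, PowerSeries.coeff_succ_X_mul, PowerSeries.coeff_C,
          if_neg (Nat.succ_ne_zero n), zero_add]
      · change PowerSeries.coeff n (a * b) =
          PowerSeries.coeff (n + 1) (a * (PowerSeries.X * b))
        rw [mul_left_comm, PowerSeries.coeff_succ_X_mul]
      · rfl
      · change -PowerSeries.coeff n (-(c * b)) =
          PowerSeries.coeff (n + 1) (c * (PowerSeries.X * b))
        rw [mul_left_comm, PowerSeries.coeff_succ_X_mul, map_neg, neg_neg]
  refine Matrix.ext fun i j => ?_
  change ofPower _ = ofPower _
  rw [key]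

end Resolvent

/-! ### Power series data of a pair of wave functions. -/

section WaveSeries

variable {𝓕 : Type u} [CommRing 𝓕] [Algebra ℂ 𝓕] (dX : Derivation ℂ 𝓕 𝓕)

theorem laxV_apply (q r : TimeSeries 𝓕) {s : PowerSeries (TimeSeries 𝓕)} {i j : Fin 2}
    (hs : basicResolvent dX q r i j = ofPower s) (k : ℕ) :
    laxV dX q r k i j = xi ^ (k + 1) * ofPower s - ofPower (negPart k s) := by
  rw [← polyPart_xi_pow_mul, ← hs]
  rfl

/-- `V_0 = ξ R_0 + R_1` is explicit in `q` and `r`, so the equations for `t_0` are available before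
the resolvent has been identified. -/
theorem laxV_zero_apply (q r : TimeSeries 𝓕) (i j : Fin 2) :
    laxV dX q r 0 i j = xi * ofPower (PowerSeries.C (resolventCoeff dX q r 0 i j)) +
      ofPower (PowerSeries.C (resolventCoeff dX q r 1 i j)) := by
  let s : PowerSeries (TimeSeries 𝓕) := PowerSeries.mk fun n => resolventCoeff dX q r n i j
  have hs : ∀ n, PowerSeries.coeff n s = resolventCoeff dX q r n i j := fun n =>
    PowerSeries.coeff_mk _ _
  rw [laxV_apply dX q r (s := s) rfl, ← hs, ← hs]
  have h := congrArg (ofPower (𝓕 := 𝓕)) (X_mul_negPart_zero s)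
  simp only [map_sub, map_mul] at h
  linear_combination -xi * h + (ofPower (negPart 0 s) +
    ofPower (PowerSeries.C (PowerSeries.coeff 1 s))) * xi_mul_ofPower_X (𝓕 := 𝓕)

/-- Power series data of a pair of wave functions: `ψ_A = a e^θ`, `ψ_B = b e^{-θ}`, and the second
components of their vectors are `c e^θ` and `ξ d e^{-θ}`. -/
structure WavePairData (q r : TimeSeries 𝓕) (ψA ψB : WaveRing 𝓕)
    (a b c d : PowerSeries (TimeSeries 𝓕)) : Prop where
  psiA : ψA = AddMonoidAlgebra.single 1 (ofPower a)
  psiB : ψB = AddMonoidAlgebra.single (-1) (ofPower b)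
  derivA : ofTime eps * waveDeriv dX 0 ψA =
    ofSpectral xi * ψA + ofTime q * AddMonoidAlgebra.single 1 (ofPower c)
  derivB : ofTime eps * waveDeriv dX 0 ψB =
    ofSpectral xi * ψB + ofTime q * AddMonoidAlgebra.single (-1) (xi * ofPower d)
  det : a * d - c * (PowerSeries.X * b) = -2
  resolvent : basicResolvent dX q r = (rankOneResolvent a (PowerSeries.X * b) c d).map ofPower
  deriv_a : ∀ p, coeffDeriv Unit (scaledDerivation dX p) a =
    -(negPart p (-(a * d)) * a + negPart p (a * (PowerSeries.X * b)) * c)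
  deriv_c : ∀ p, coeffDeriv Unit (scaledDerivation dX p) c =
    -(negPart p (-(c * d)) * a + negPart p (c * (PowerSeries.X * b)) * c)
  deriv_b : ∀ p, coeffDeriv Unit (scaledDerivation dX p) (PowerSeries.X * b) =
    -(negPart p (-(a * d)) * (PowerSeries.X * b) + negPart p (a * (PowerSeries.X * b)) * d)
  deriv_d : ∀ p, coeffDeriv Unit (scaledDerivation dX p) d =
    -(negPart p (-(c * d)) * (PowerSeries.X * b) + negPart p (c * (PowerSeries.X * b)) * d)

theorem two_pow_mul_cancel (p : ℕ) {f g : PowerSeries (TimeSeries 𝓕)}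
    (h : 2 ^ p * f = 2 ^ p * g) : f = g := by
  induction p with
  | zero => simpa using h
  | succ p ih =>
    refine ih (powerSeries_two_mul_cancel ?_)
    linear_combination h

/-- The `t_0` equations and the pair condition determine the resolvent in terms of `a, b, c, d`.
Inserting this rank-one form into `V_p` then turns every wave equation into a flow generated by
negative parts only. -/
theorem exists_wavePairData {q r : TimeSeries 𝓕} (hq : IsUnit q) {ψA ψB : WaveRing 𝓕}
    (hA : IsWaveA dX q r ψA) (hB : IsWaveB dX q r ψB) (hpair : IsPair dX q ψA ψB) :
    ∃ a b c d, WavePairData dX q r ψA ψB a b c d := by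
  obtain ⟨⟨a, -, hψA⟩, hwA⟩ := hA
  obtain ⟨⟨φB, -, hψB⟩, hwB⟩ := hB
  obtain ⟨b, hb_def⟩ : ∃ b, b = φB * PowerSeries.C q := ⟨_, rfl⟩
  replace hψB : ψB = AddMonoidAlgebra.single (-1) (ofPower b) := by
    rw [hψB, hahnSeries_C_eq, ← map_mul, hb_def]
  obtain ⟨qi, hqi⟩ : ∃ qi, qi = Ring.inverse q := ⟨_, rfl⟩
  have hqq : q * qi = 1 := hqi ▸ Ring.mul_inverse_cancel q hq
  have hqq' : PowerSeries.C q * PowerSeries.C qi = 1 := by rw [← map_mul, hqq, map_one]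
  have hee : ofPower (PowerSeries.C (eps : TimeSeries 𝓕)) * ofPower (PowerSeries.C epsInv) = 1 := by
    rw [← map_mul, ← map_mul, eps_mul_epsInv, map_one, map_one]
  have hxX := xi_mul_ofPower_X (𝓕 := 𝓕)
  obtain ⟨c, hc_def⟩ : ∃ c, c = PowerSeries.C qi * (PowerSeries.C eps * powerDeriv dX 0 a) :=
    ⟨_, rfl⟩
  -- The second component of the type B vector divided by `ξ`, hence the factor `X` on the
  -- derivative and the term `-2 b`.
  obtain ⟨d, hd_def⟩ : ∃ d, d = PowerSeries.C qi *
      (PowerSeries.X * (PowerSeries.C eps * powerDeriv dX 0 b) - 2 * b) := ⟨_, rfl⟩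
  rw [hψA] at hwA
  rw [hψB] at hwB
  have eA := hwA.single dX (v := ![ofPower a, ofPower c]) (by
    rw [hc_def, spectralDeriv_ofPower]
    simp only [hahnSeries_C_eq, map_mul, Int.cast_one, sub_self, zero_mul, add_zero, hqi])
  have eB := hwB.single dX (v := ![ofPower b, xi * ofPower d]) (by
    rw [hd_def, spectralDeriv_ofPower]
    congr 2
    simp only [hahnSeries_C_eq, map_mul, map_sub, map_ofNat, Int.cast_neg, Int.cast_one]
    rw [← hqi]
    linear_combination ofPower (PowerSeries.C qi) * ofPower (PowerSeries.C eps) *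
      ofPower (powerDeriv dX 0 b) * hxX)
  have ha : PowerSeries.C eps * powerDeriv dX 0 a = PowerSeries.C q * c := by
    rw [hc_def]
    linear_combination -(PowerSeries.C eps * powerDeriv dX 0 a) * hqq'
  have hb : PowerSeries.X * (PowerSeries.C eps * powerDeriv dX 0 b) =
      PowerSeries.C q * d + 2 * b := by
    rw [hd_def]
    linear_combination
      -(PowerSeries.X * (PowerSeries.C eps * powerDeriv dX 0 b) - 2 * b) * hqq'
  have hc : PowerSeries.X * (PowerSeries.C eps * powerDeriv dX 0 c) =
      -(PowerSeries.C r * (PowerSeries.X * a)) - 2 * c := by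
    have h := eA 0 1
    simp only [laxV_zero_apply, resolventCoeff, resolventABC, Matrix.cons_val_zero,
      Matrix.cons_val_one, Matrix.cons_val_fin_one, Matrix.of_apply, spectralDeriv_ofPower,
      hahnSeries_C_eq, map_neg, map_zero, Int.cast_one, neg_zero, pow_zero, zero_add, pow_one] at h
    apply ofPower_injective
    simp only [map_mul, map_sub, map_neg, map_ofNat]
    linear_combination ofPower PowerSeries.X * h - 2 * ofPower c * hxX
  have hd : PowerSeries.C eps * powerDeriv dX 0 d =
      -(PowerSeries.C r * (PowerSeries.X * b)) := by
    have h := eB 0 1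
    simp only [laxV_zero_apply, resolventCoeff, resolventABC, Matrix.cons_val_zero,
      Matrix.cons_val_one, Matrix.cons_val_fin_one, Matrix.of_apply, spectralDeriv_ofPower,
      spectralDeriv_xi_mul, hahnSeries_C_eq, map_neg, map_zero, Int.cast_neg, Int.cast_one,
      neg_zero, pow_zero, zero_add, pow_one] at h
    apply ofPower_injective
    simp only [map_mul, map_neg]
    linear_combination ofPower PowerSeries.X * h -
      ofPower (PowerSeries.C eps) * ofPower (powerDeriv dX 0 d) * hxX
  have hder : ∀ (n : ℤ) (f : PowerSeries (TimeSeries 𝓕)),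
      ofTime eps * waveDeriv dX 0 (AddMonoidAlgebra.single n (ofPower f)) =
        AddMonoidAlgebra.single n (ofPower (PowerSeries.C eps * powerDeriv dX 0 f) +
          (n : SpectralSeries 𝓕) * xi * ofPower f) := by
    intro n f
    rw [waveDeriv_single, spectralDeriv_ofPower]
    change ofSpectral (HahnSeries.C eps) * _ = _
    rw [ofSpectral_mul_single]
    congr 1
    simp only [hahnSeries_C_eq, map_mul]
    linear_combination n * xi * ofPower f * hee
  have hderA : ofTime eps * waveDeriv dX 0 ψA =
      ofSpectral xi * ψA + ofTime q * AddMonoidAlgebra.single 1 (ofPower c) := by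
    rw [hψA, hder, ofSpectral_mul_single]
    change _ = _ + ofSpectral (HahnSeries.C q) * _
    rw [ofSpectral_mul_single, ← AddMonoidAlgebra.single_add, ha]
    congr 1
    simp only [hahnSeries_C_eq, map_mul, Int.cast_one]
    ring
  have hderB : ofTime eps * waveDeriv dX 0 ψB =
      ofSpectral xi * ψB + ofTime q * AddMonoidAlgebra.single (-1) (xi * ofPower d) := by
    rw [hψB, hder, ofSpectral_mul_single]
    change _ = _ + ofSpectral (HahnSeries.C q) * _
    rw [ofSpectral_mul_single, ← AddMonoidAlgebra.single_add]
    congr 1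
    have h := congrArg ofPower hb
    simp only [hahnSeries_C_eq, map_mul, map_add, map_ofNat, Int.cast_neg, Int.cast_one] at h ⊢
    linear_combination xi * h -
      ofPower (PowerSeries.C eps) * ofPower (powerDeriv dX 0 b) * hxX
  have hdet : a * d - c * (PowerSeries.X * b) = -2 := by
    have h : (ψA * (ofTime eps * waveDeriv dX 0 ψB) - ofTime eps * waveDeriv dX 0 ψA * ψB) *
        ofTime qi = -2 * ofSpectral xi := by
      rw [hqi, ← hpair]
      ring
    rw [hderA, hderB] at h
    have hqT : (ofTime q : WaveRing 𝓕) * ofTime qi = 1 := by rw [← map_mul, hqq, map_one]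
    have h' : ψA * AddMonoidAlgebra.single (-1) (xi * ofPower d) -
        AddMonoidAlgebra.single 1 (ofPower c) * ψB = ofSpectral (-2 * xi) := by
      rw [map_mul, map_neg, map_ofNat]
      linear_combination h - (ψA * AddMonoidAlgebra.single (-1) (xi * ofPower d) -
        AddMonoidAlgebra.single 1 (ofPower c) * ψB) * hqT
    rw [hψA, hψB, AddMonoidAlgebra.single_mul_single, AddMonoidAlgebra.single_mul_single,
      ← AddMonoidAlgebra.single_sub] at h'
    have h'' : ofPower a * (xi * ofPower d) - ofPower c * ofPower b = -2 * xi :=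
      AddMonoidAlgebra.single_right_inj.1 h'
    apply ofPower_injective
    simp only [map_mul, map_sub, map_neg, map_ofNat]
    linear_combination ofPower PowerSeries.X * h'' -
      (ofPower a * ofPower d + 2) * hxX
  -- The `t_0` equation for `c` shows that `2 c`, hence `c`, has no constant term.
  have hγ : PowerSeries.X ∣ c * d := by
    have h1 : PowerSeries.X ∣ 2 * c := by
      refine ⟨-(PowerSeries.C r * a) - PowerSeries.C eps * powerDeriv dX 0 c, ?_⟩
      linear_combination hc
    obtain ⟨γ, hγ⟩ := h1
    refine Dvd.dvd.mul_right ?_ d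
    refine ⟨PowerSeries.C (algebraMap ℂ (TimeSeries 𝓕) (1 / 2)) * γ, ?_⟩
    apply powerSeries_two_mul_cancel
    have h2 : PowerSeries.C (algebraMap ℂ (TimeSeries 𝓕) (1 / 2)) * 2 = 1 := by
      rw [← map_ofNat PowerSeries.C 2, ← map_mul, algebraMap_half_mul_two, map_one]
    linear_combination hγ - PowerSeries.X * γ * h2
  have hR := basicResolvent_eq dX hdet hγ (resolventABC_eq dX hdet ha hb hc hd)
  have hV := fun i j k => laxV_apply dX q r (s := rankOneResolvent a (PowerSeries.X * b) c d i j)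
    (i := i) (j := j) (by rw [hR]; rfl) k
  have hdetL := congrArg ofPower hdet
  simp only [map_mul, map_sub, map_neg, map_ofNat] at hdetL
  refine ⟨a, b, c, d, hψA, hψB, hderA, hderB, hdet, hR, fun p => ?_, fun p => ?_, fun p => ?_,
    fun p => ?_⟩
  · apply two_pow_mul_cancel p
    rw [coeffDeriv_scaledDerivation]
    apply ofPower_injective
    have h := eA p 0
    simp only [hV, rankOneResolvent, Matrix.cons_val_zero, Matrix.cons_val_one,
      Matrix.cons_val_fin_one, Matrix.of_apply, spectralDeriv_ofPower, hahnSeries_C_eq,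
      Int.cast_one] at h
    simp only [map_mul, map_neg, map_add, map_pow, map_ofNat] at h ⊢
    -- `R u = 2 u` by the determinant relation, so the terms with `ξ^{p+1}` cancel between `R`, the
    -- subtracted identity and the derivative of `e^θ`.
    linear_combination h - 2 ^ p * xi ^ (p + 1) * ofPower a * hdetL
  · apply two_pow_mul_cancel p
    rw [coeffDeriv_scaledDerivation]
    apply ofPower_injective
    have h := eA p 1
    simp only [hV, rankOneResolvent, Matrix.cons_val_zero, Matrix.cons_val_one,
      Matrix.cons_val_fin_one, Matrix.of_apply, spectralDeriv_ofPower, hahnSeries_C_eq,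
      Int.cast_one] at h
    simp only [map_mul, map_neg, map_add, map_pow, map_ofNat] at h ⊢
    linear_combination h - 2 ^ p * xi ^ (p + 1) * ofPower c * hdetL
  · apply two_pow_mul_cancel p
    rw [coeffDeriv_scaledDerivation, powerDeriv_X_mul]
    apply ofPower_injective
    have h := eB p 0
    simp only [hV, rankOneResolvent, Matrix.cons_val_zero, Matrix.cons_val_one,
      Matrix.cons_val_fin_one, Matrix.of_apply, spectralDeriv_ofPower, hahnSeries_C_eq,
      Int.cast_one, Int.cast_neg] at h
    simp only [map_mul, map_neg, map_add, map_pow, map_ofNat] at h ⊢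
    -- The type B vector is `ξ (X b, d)`, hence the multiplication by `X`. Here `R v = 0`
    -- identically, and the subtracted `ξ^{p+1}` cancels against the derivative of `e^{-θ}`.
    linear_combination ofPower PowerSeries.X * h - 2 ^ p * ofPower d *
      ofPower (negPart p (a * (PowerSeries.X * b))) * hxX + 2 ^ p * xi ^ (p + 1) *
      ofPower a * ofPower d * ofPower PowerSeries.X * ofPower b * hxX
  · apply two_pow_mul_cancel p
    rw [coeffDeriv_scaledDerivation]
    apply ofPower_injective
    have h := eB p 1
    simp only [hV, rankOneResolvent, Matrix.cons_val_zero, Matrix.cons_val_one,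
      Matrix.cons_val_fin_one, Matrix.of_apply, spectralDeriv_ofPower, hahnSeries_C_eq,
      spectralDeriv_xi_mul, Int.cast_one, Int.cast_neg] at h
    simp only [map_mul, map_neg, map_add, map_pow, map_ofNat] at h ⊢
    linear_combination ofPower PowerSeries.X * h - 2 ^ p * ofPower d *
      ofPower (negPart p (c * (PowerSeries.X * b))) * hxX + 2 ^ p * xi ^ (p + 1) *
      ofPower c * ofPower d * ofPower PowerSeries.X * ofPower b * hxX -
      ofPower (PowerSeries.C eps) * ofPower (powerDeriv dX p d) * hxX

end WaveSeries

/-! ### Several spectral parameters: from the wedge kernel to `D`, and the two-point function. -/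

section SeveralParameters

variable {𝓕 : Type u} [CommRing 𝓕] {k : ℕ}

theorem ringInverse_eq_of_mul_eq_one {A : Type*} [CommRing A] {x y : A} (h : x * y = 1) :
    Ring.inverse x = y := by
  have hx : IsUnit x := IsUnit.of_mul_eq_one y h
  calc Ring.inverse x = Ring.inverse x * (x * y) := by rw [h, mul_one]
    _ = y := by rw [← mul_assoc, Ring.inverse_mul_cancel _ hx, one_mul]

/-- The identification of the two localizations. -/
def toMulti : DifferenceLocalization (TimeSeries 𝓕) k →+* MultiSpectral 𝓕 k :=
  RingHom.id (DifferenceLocalization (TimeSeries 𝓕) k)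

theorem toMulti_injective : Function.Injective (toMulti (𝓕 := 𝓕) (k := k)) := fun _ _ h => h

theorem toMulti_toLoc (s : MvPowerSeries (Fin k) (TimeSeries 𝓕)) :
    toMulti (toLoc s) = algebraMap _ (MultiSpectral 𝓕 k) s := rfl

theorem place_ofPower (j : Fin k) (s : PowerSeries (TimeSeries 𝓕)) :
    place j (ofPower s) = toMulti (toLoc (seriesAt j s)) :=
  IsLocalization.lift_eq (isUnit_placePowerSeries j) s

/-- The coefficients of the exponentials as elements of the ring with formal exponentials. -/
def toWave : DifferenceLocalization (TimeSeries 𝓕) k →+* MultiWave 𝓕 k :=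
  AddMonoidAlgebra.singleZeroRingHom.comp toMulti

/-- The exponential `e^{nθ(ξ_j)}`. -/
def expAt (j : Fin k) (n : ℤ) : MultiWave 𝓕 k := AddMonoidAlgebra.single (Pi.single j n) 1

theorem expAt_mul_expAt_neg (j : Fin k) (n : ℤ) : expAt (𝓕 := 𝓕) j n * expAt j (-n) = 1 := by
  rw [expAt, expAt, AddMonoidAlgebra.single_mul_single, ← Pi.single_add, add_neg_cancel,
    Pi.single_zero, mul_one]
  rfl

theorem ofSeries_eq (s : MvPowerSeries (Fin k) (TimeSeries 𝓕)) : ofSeries s = toWave (toLoc s) :=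
  rfl

theorem waveAt_single (j : Fin k) (n : ℤ) (s : PowerSeries (TimeSeries 𝓕)) :
    waveAt j (AddMonoidAlgebra.single n (ofPower s)) =
      toWave (toLoc (seriesAt j s)) * expAt j n := by
  have h : waveAt j (AddMonoidAlgebra.single n (ofPower s)) =
      AddMonoidAlgebra.single (Pi.single j n) (place j (ofPower s)) := by
    change AddMonoidAlgebra.mapDomainRingHom _ _ (AddMonoidAlgebra.mapRingHom ℤ (place j)
      (AddMonoidAlgebra.single n (ofPower s))) = _
    rw [AddMonoidAlgebra.mapRingHom_single, AddMonoidAlgebra.mapDomainRingHom_apply,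
      AddMonoidAlgebra.mapDomain_single]
    rfl
  rw [h, place_ofPower, toWave, expAt]
  change _ = AddMonoidAlgebra.single 0 _ * _
  rw [AddMonoidAlgebra.single_mul_single, zero_add, mul_one]

theorem waveAt_ofSpectral (j : Fin k) (s : PowerSeries (TimeSeries 𝓕)) :
    waveAt j (ofSpectral (ofPower s)) = toWave (toLoc (seriesAt j s)) := by
  have h := waveAt_single j 0 s
  have h0 : expAt (𝓕 := 𝓕) j 0 = 1 := by
    rw [expAt, Pi.single_zero]
    rfl
  rw [h0, mul_one] at h
  exact h

theorem waveAt_ofTime (j : Fin k) (t : TimeSeries 𝓕) :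
    waveAt j (ofTime t) = ofSeries (MvPowerSeries.C t) := by
  have h := waveAt_ofSpectral j (PowerSeries.C t)
  rw [seriesAt_C, ← hahnSeries_C_eq] at h
  exact h

theorem xiAt_mul_X (j : Fin k) :
    xiAt (𝓕 := 𝓕) j * toWave (toLoc (MvPowerSeries.X j)) = 1 := by
  rw [← seriesAt_X, ← waveAt_ofSpectral, xiAt, ← map_mul, ← map_mul, xi_mul_ofPower_X, map_one,
    map_one]

theorem place_xi_mul_X (j : Fin k) :
    place (𝓕 := 𝓕) j xi * toMulti (toLoc (MvPowerSeries.X j)) = 1 := by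
  rw [← seriesAt_X, ← place_ofPower, ← map_mul, xi_mul_ofPower_X, map_one]

/-- The element `(ξ_i - ξ_j)⁻¹` in terms of the variables `ξ_i⁻¹`. -/
def inverseDifference {T : Type u} [CommRing T] (i j : Fin k) : DifferenceLocalization T k :=
  toLoc (MvPowerSeries.X i) * toLoc (MvPowerSeries.X j) *
    Ring.inverse (toLoc (MvPowerSeries.X j - MvPowerSeries.X i))

theorem sub_mul_map_inverseDifference {T : Type u} [CommRing T] {A : Type*} [CommRing A]
    (f : DifferenceLocalization T k →+* A) {i j : Fin k} (hij : i ≠ j) {x y : A}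
    (hx : x * f (toLoc (MvPowerSeries.X i)) = 1) (hy : y * f (toLoc (MvPowerSeries.X j)) = 1) :
    (x - y) * f (inverseDifference i j) = 1 := by
  have h := congrArg f (Ring.mul_inverse_cancel _ (isUnit_toLoc_X_sub_X (T := T) hij.symm))
  rw [inverseDifference]
  simp only [map_mul, map_sub, map_one] at h ⊢
  linear_combination h + f (toLoc (MvPowerSeries.X j)) * f (Ring.inverse
    (toLoc (MvPowerSeries.X j) - toLoc (MvPowerSeries.X i))) * hx -
    f (toLoc (MvPowerSeries.X i)) * f (Ring.inverse
    (toLoc (MvPowerSeries.X j) - toLoc (MvPowerSeries.X i))) * hy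

theorem sub_mul_xiAt {i j : Fin k} (hij : i ≠ j) :
    (xiAt (𝓕 := 𝓕) i - xiAt j) * toWave (inverseDifference i j) = 1 := by
  have hi := xiAt_mul_X (𝓕 := 𝓕) i
  have hj := xiAt_mul_X (𝓕 := 𝓕) j
  generalize xiAt (𝓕 := 𝓕) i = x at *
  generalize xiAt (𝓕 := 𝓕) j = y at *
  have h := congrArg toWave
    (Ring.mul_inverse_cancel _ (isUnit_toLoc_X_sub_X (T := TimeSeries 𝓕) hij.symm))
  rw [inverseDifference]
  simp only [map_mul, map_sub, map_one] at h ⊢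
  generalize toWave (𝓕 := 𝓕) (toLoc (MvPowerSeries.X i)) = u at *
  generalize toWave (𝓕 := 𝓕) (toLoc (MvPowerSeries.X j)) = v at *
  generalize toWave (𝓕 := 𝓕)
    (Ring.inverse (toLoc (MvPowerSeries.X j) - toLoc (MvPowerSeries.X i))) = w at *
  linear_combination h + v * w * hi - u * w * hj

theorem ringInverse_xiAt_sub_xiAt {i j : Fin k} (hij : i ≠ j) :
    Ring.inverse (xiAt (𝓕 := 𝓕) i - xiAt j) = toWave (inverseDifference i j) :=
  ringInverse_eq_of_mul_eq_one (A := MultiWave 𝓕 k) (sub_mul_xiAt hij)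

theorem ringInverse_place_xi_sub_sq {i j : Fin k} (hij : i ≠ j) :
    Ring.inverse ((place (𝓕 := 𝓕) i xi - place j xi) ^ 2) =
      toMulti (inverseDifference i j ^ 2) := by
  apply ringInverse_eq_of_mul_eq_one
  rw [map_pow, ← mul_pow,
    sub_mul_map_inverseDifference toMulti hij (place_xi_mul_X i) (place_xi_mul_X j), one_pow]

theorem ringInverse_xiAt_sub_sq {i j : Fin k} (hij : i ≠ j) :
    Ring.inverse ((xiAt (𝓕 := 𝓕) i - xiAt j) ^ 2) = toWave (inverseDifference i j ^ 2) := by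
  refine ringInverse_eq_of_mul_eq_one (A := MultiWave 𝓕 k) ?_
  rw [map_pow]
  linear_combination
    ((xiAt (𝓕 := 𝓕) i - xiAt j) * toWave (inverseDifference (T := TimeSeries 𝓕) i j) + 1) *
      sub_mul_xiAt (𝓕 := 𝓕) hij

variable [Algebra ℂ 𝓕] (dX : Derivation ℂ 𝓕 𝓕)

/-- Substituting `ε ψ_X = ξ ψ + q χ`, with `χ` the second component of the wave vector, produces
`-(ξ_i - ξ_j) ψ_A ψ_B`, which the second summand of `D` is there to cancel. What remains is the
wedge of the two wave vectors over `ξ_i - ξ_j`; the type B vector supplies the factor `ξ_j`. -/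
theorem kernelD_eq {q r : TimeSeries 𝓕} (hq : IsUnit q) {ψA ψB : WaveRing 𝓕}
    {a b c d : PowerSeries (TimeSeries 𝓕)} (h : WavePairData dX q r ψA ψB a b c d)
    {i j : Fin k} (hij : i ≠ j) :
    kernelD dX q ψA ψB i j = toWave (wedgeKernel a (PowerSeries.X * b) c d i j) *
      (xiAt j * (expAt i 1 * expAt j (-1))) := by
  have hqq : ofSeries (k := k) (MvPowerSeries.C q) *
      ofSeries (MvPowerSeries.C (Ring.inverse q)) = 1 := by
    rw [← map_mul, ← map_mul, Ring.mul_inverse_cancel q hq, map_one, map_one]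
  have hA := congrArg (waveAt i) h.derivA
  have hB := congrArg (waveAt j) h.derivB
  have hχ : waveAt j (AddMonoidAlgebra.single (-1) (xi * ofPower d)) =
      xiAt j * (toWave (toLoc (seriesAt j d)) * expAt j (-1)) := by
    rw [← waveAt_single, xiAt, ← map_mul, ofSpectral_mul_single]
  simp only [map_mul, map_add, waveAt_ofTime, waveAt_single] at hA hB
  rw [hχ] at hB
  change _ = xiAt i * _ + _ at hA
  change _ = xiAt j * _ + _ at hB
  have hinv := sub_mul_xiAt (𝓕 := 𝓕) hij
  have hψA : waveAt i ψA = toWave (toLoc (seriesAt i a)) * expAt i 1 := by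
    rw [h.psiA, waveAt_single]
  have hψB : waveAt j ψB = toWave (toLoc (seriesAt j b)) * expAt j (-1) := by
    rw [h.psiB, waveAt_single]
  have hz := xiAt_mul_X (𝓕 := 𝓕) j
  rw [hψA] at hA
  rw [hψB] at hB
  have hwedge : toWave (wedgeKernel a (PowerSeries.X * b) c d i j) =
      (toWave (toLoc (seriesAt i a)) * toWave (toLoc (seriesAt j d)) -
        toWave (toLoc (seriesAt i c)) * (toWave (toLoc (MvPowerSeries.X j)) *
          toWave (toLoc (seriesAt j b)))) * toWave (inverseDifference i j) := by
    have hk : wedgeKernel a (PowerSeries.X * b) c d i j =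
        toLoc (seriesAt i a * seriesAt j d - seriesAt i c * seriesAt j (PowerSeries.X * b)) *
          inverseDifference i j := rfl
    rw [hk]
    simp only [map_mul, map_sub, seriesAt_X]
  rw [kernelD, ringInverse_xiAt_sub_xiAt hij, hψA, hψB, hwedge]
  generalize toWave (𝓕 := 𝓕) (inverseDifference (T := TimeSeries 𝓕) i j) = δ at *
  generalize toWave (𝓕 := 𝓕) (toLoc (seriesAt i a)) = ai at *
  generalize toWave (𝓕 := 𝓕) (toLoc (seriesAt j b)) = bj at *
  generalize toWave (𝓕 := 𝓕) (toLoc (seriesAt i c)) = ci at *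
  generalize toWave (𝓕 := 𝓕) (toLoc (seriesAt j d)) = dj at *
  generalize toWave (𝓕 := 𝓕) (toLoc (MvPowerSeries.X j)) = zj at *
  generalize ofSeries (𝓕 := 𝓕) (MvPowerSeries.C q) = Q at *
  generalize ofSeries (𝓕 := 𝓕) (MvPowerSeries.C (Ring.inverse q)) = Q' at *
  generalize ofSeries (𝓕 := 𝓕) (MvPowerSeries.C eps) = e at *
  generalize waveAt (𝓕 := 𝓕) i (waveDeriv dX 0 ψA) = dA at *
  generalize waveAt (𝓕 := 𝓕) j (waveDeriv dX 0 ψB) = dB at *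
  generalize xiAt (𝓕 := 𝓕) i = x at *
  generalize xiAt (𝓕 := 𝓕) j = y at *
  generalize expAt (𝓕 := 𝓕) i 1 = e1 at *
  generalize expAt (𝓕 := 𝓕) j (-1) = e2 at *
  linear_combination ai * e1 * δ * Q' * hB - bj * e2 * δ * Q' * hA -
    ai * e1 * bj * e2 * Q' * hinv + (ai * e1 * y * dj * e2 - ci * e1 * bj * e2) * δ * hqq +
    ci * bj * e1 * e2 * δ * hz

/-- In a cyclic product every index occurs once as first and once as second argument. The
exponentials therefore cancel, and the factors `ξ_j` multiply to the same product for every cycle.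
-/
theorem cyclicSum_kernelD {q r : TimeSeries 𝓕} (hq : IsUnit q) {ψA ψB : WaveRing 𝓕}
    {a b c d : PowerSeries (TimeSeries 𝓕)} (h : WavePairData dX q r ψA ψB a b c d) (n : ℕ) :
    cyclicSum (fun i j : Fin (n + 2) => kernelD dX q ψA ψB i j) =
      (∏ j : Fin (n + 2), xiAt j) *
        toWave (cyclicSum (wedgeKernel (k := n + 2) a (PowerSeries.X * b) c d)) := by
  rw [cyclicSum, cyclicSum, map_sum, Finset.mul_sum]
  refine Finset.sum_congr rfl fun x _ => ?_
  induction x using Quotient.inductionOn' with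
  | h σ =>
  change ∏ j, _ = _ * toWave (∏ j, _)
  have hne : ∀ j, σ (finRotate (n + 2) j) ≠ σ j := fun j h => finRotate_ne j (σ.injective h)
  rw [Finset.prod_congr rfl fun j _ => kernelD_eq dX hq h (hne j), Finset.prod_mul_distrib,
    Finset.prod_mul_distrib, Finset.prod_mul_distrib, map_prod]
  have h1 : ∏ j, expAt (𝓕 := 𝓕) (σ (finRotate (n + 2) j)) 1 = ∏ j, expAt j 1 := by
    rw [Equiv.prod_comp (finRotate (n + 2)) fun j => expAt (𝓕 := 𝓕) (σ j) 1,
      Equiv.prod_comp σ fun j => expAt (𝓕 := 𝓕) j 1]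
  rw [h1, Equiv.prod_comp σ fun j => expAt (𝓕 := 𝓕) j (-1),
    Equiv.prod_comp σ fun j => xiAt (𝓕 := 𝓕) j, ← Finset.prod_mul_distrib,
    Finset.prod_congr rfl fun j _ => expAt_mul_expAt_neg (𝓕 := 𝓕) j 1, Finset.prod_const_one,
    mul_one]
  ring

omit [Algebra ℂ 𝓕] in
theorem isUnit_prod_xiAt : IsUnit (∏ j : Fin k, xiAt (𝓕 := 𝓕) j) := by
  have h : (∏ j : Fin k, xiAt (𝓕 := 𝓕) j) * ∏ j, toWave (toLoc (MvPowerSeries.X j)) = 1 := by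
    rw [← Finset.prod_mul_distrib, Finset.prod_congr rfl fun j _ => xiAt_mul_X (𝓕 := 𝓕) j,
      Finset.prod_const_one]
  exact ⟨⟨_, _, h, by linear_combination h⟩, rfl⟩

theorem cyclicSum_two {M : Type*} [CommRing M] (h2 : IsUnit (2 : M)) (f : Fin 2 → Fin 2 → M) :
    cyclicSum f = f 1 0 * f 0 1 := by
  have h := nsmul_cyclicSum le_rfl f
  rw [permSum_succ (n := 0)] at h
  have h' := nsmul_left_cancel_of_isUnit (m := 2) (by exact_mod_cast h2) h
  have : Subsingleton (Equiv.Perm (Fin (0 + 1))) :=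
    inferInstanceAs (Subsingleton (Equiv.Perm (Fin 1)))
  rw [h', Fintype.sum_subsingleton _ 1, insertedProd]
  simp

/-- For rank-one resolvents `tr R(ξ)R(ν) = (u(ξ) ∧ v(ν)) (u(ν) ∧ v(ξ))`. The minus sign before the
cyclic sum comes from `(ξ - ν)(ν - ξ) = -(ξ - ν)²`. -/
theorem toLoc_correlationSeries_two {q r logτ : TimeSeries 𝓕} (hτ : IsLogTau dX q r logτ)
    {ψA ψB : WaveRing 𝓕} {a b c d : PowerSeries (TimeSeries 𝓕)}
    (h : WavePairData dX q r ψA ψB a b c d) :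
    toLoc (correlationSeries dX logτ 2) =
      -cyclicSum (wedgeKernel (k := 2) a (PowerSeries.X * b) c d) -
        4 * inverseDifference 0 1 ^ 2 := by
  have hunit : IsUnit (2 : DifferenceLocalization (TimeSeries 𝓕) 2) := by
    have := (isUnit_natCast_timeSeries (𝓕 := 𝓕) 2 two_ne_zero).map
      ((toLoc (T := TimeSeries 𝓕) (k := 2)).comp MvPowerSeries.C)
    rw [map_natCast] at this
    exact_mod_cast this
  have h01 : (0 : Fin 2) ≠ 1 := by decide
  have hneg : inverseDifference (T := TimeSeries 𝓕) (1 : Fin 2) 0 =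
      -inverseDifference (T := TimeSeries 𝓕) (0 : Fin 2) 1 := by
    rw [inverseDifference, inverseDifference,
      ← neg_sub (MvPowerSeries.X 1 : MvPowerSeries (Fin 2) (TimeSeries 𝓕)) (MvPowerSeries.X 0),
      map_neg,
      ringInverse_neg (isUnit_toLoc_X_sub_X h01.symm)]
    ring
  apply toMulti_injective
  rw [toMulti_toLoc, hτ, h.resolvent, ringInverse_place_xi_sub_sq h01, cyclicSum_two hunit]
  have hk : ∀ i j : Fin 2, wedgeKernel a (PowerSeries.X * b) c d i j =
      toLoc (seriesAt i a * seriesAt j d - seriesAt i c * seriesAt j (PowerSeries.X * b)) *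
        inverseDifference i j := fun i j => rfl
  rw [hk, hk, hneg]
  simp only [Matrix.trace_fin_two, Matrix.mul_apply, Fin.sum_univ_two, Matrix.map_apply,
    rankOneResolvent, Matrix.cons_val_zero, Matrix.cons_val_one, Matrix.cons_val_fin_one,
    Matrix.of_apply, place_ofPower, map_mul, map_neg, map_sub, map_pow, map_ofNat]
  ring

end SeveralParameters

end AKNS

end

/-! ### The formula for all k-point functions. -/

theorem theorem1p1 {𝓕 : Type*} [CommRing 𝓕] [Algebra ℂ 𝓕] (dX : Derivation ℂ 𝓕 𝓕)
    (q r : AKNS.TimeSeries 𝓕) (hq : IsUnit q) (hqr : AKNS.IsSolution dX q r)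
    (logτ : AKNS.TimeSeries 𝓕) (hτ : AKNS.IsLogTau dX q r logτ)
    (ψA ψB : AKNS.WaveRing 𝓕)
    (hA : AKNS.IsWaveA dX q r ψA) (hB : AKNS.IsWaveB dX q r ψB)
    (hpair : AKNS.IsPair dX q ψA ψB)
    (k : ℕ) (hk : 2 ≤ k) :
    AKNS.ofSeries (AKNS.correlationSeries dX logτ k) =
      -(Ring.inverse (∏ j : Fin k, AKNS.xiAt (𝓕 := 𝓕) j) *
          AKNS.cyclicSum (fun i j : Fin k => AKNS.kernelD dX q ψA ψB i j)) -
        (if k = 2 then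
          4 * Ring.inverse ((AKNS.xiAt (𝓕 := 𝓕) (⟨0, by omega⟩ : Fin k) -
            AKNS.xiAt (⟨1, by omega⟩ : Fin k)) ^ 2)
        else 0) := by
  obtain ⟨a, b, c, d, h⟩ := AKNS.exists_wavePairData dX hq hA hB hpair
  obtain ⟨n, rfl⟩ : ∃ n, k = n + 2 := ⟨k - 2, by omega⟩
  rw [AKNS.cyclicSum_kernelD dX hq h, ← mul_assoc,
    Ring.inverse_mul_cancel _ AKNS.isUnit_prod_xiAt, one_mul, AKNS.ofSeries_eq]
  have h2 := AKNS.toLoc_correlationSeries_two dX hτ h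
  cases n with
  | zero =>
    rw [if_pos rfl, AKNS.ringInverse_xiAt_sub_sq (by simp), h2, map_sub, map_neg,
      map_mul, map_ofNat]
    rfl
  | succ n =>
    have e := congrArg AKNS.toWave (AKNS.toLoc_eq_neg_cyclicSum AKNS.isUnit_natCast_timeSeries
      (AKNS.scaledDerivation dX) h.det h.deriv_a h.deriv_c h.deriv_b h.deriv_d
      (AKNS.correlationSeries dX logτ) (AKNS.insertion_correlationSeries dX logτ) h2 n)
    rw [map_neg] at e
    rw [if_neg (by omega)]
    linear_combination e
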